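/- **Linear erasure for the asymmetric signal-rule (ASR).** Every site $i\in\mathbb Z$ carries four binary registers $\mathrm{Def}_i,\mathrm{FwS}_i,\mathrm{BwS}_i,\mathrm{AnS}_i\in\{0,1\}$ (defect, forward-signal, backward-signal, anti-signal) and a stack $\mathrm{Sta}_i\in\mathbb N$. For a configuration $u\in(\{0,1\}^4\times\mathbb N)^{\mathbb Z}$ let $\Sigma(u)=\{i:\mathrm{Def}_i=1\}$, and let $\mathrm{supp}(u)$ be the set of sites at which some register is nonzero. One iteration of the ASR, with anti-signals and backward-signals of speed $3$, applies the following steps in order, each step simultaneously at all sites $i$: 1. Let $\mathrm{Cor}_i=1$ if $(\mathrm{Def}_{i-1},\mathrm{Def}_i,\mathrm{Def}_{i+1})=(0,1,1)$ and $\mathrm{Cor}_i=0$ otherwise; then set $\mathrm{Def}_i$ to $0$ if $\mathrm{Cor}_i=1$ or $\mathrm{Cor}_{i-1}=1$. 2. If $\mathrm{Def}_i=1$, $\mathrm{Def}_{i+1}=0$ and $\mathrm{FwS}_i=0$, set $\mathrm{FwS}_i$ to $1$ and increment $\mathrm{Sta}_i$ by $1$. 3. Replace $\mathrm{FwS}_i$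 by $\mathrm{FwS}_{i-1}$. 4. Let $\mathrm{Tmp}_i=1$ if $\mathrm{Def}_i=\mathrm{FwS}_i=1$ and $\mathrm{Tmp}_i=0$ otherwise. Where $\mathrm{Tmp}_i=1$, set $\mathrm{Def}_i$ to $0$ and, if $(\mathrm{FwS}_i,\mathrm{BwS}_i)=(1,0)$, replace this pair by $(0,1)$. Then, where $\mathrm{Tmp}_{i+1}=1$, set $\mathrm{Def}_i$ to $1$ and, if $(\mathrm{FwS}_i,\mathrm{BwS}_i)=(1,0)$, replace this pair by $(0,1)$. 5. Three times: replace $\mathrm{BwS}_i$ by $\mathrm{BwS}_{i+1}$; then, if $\mathrm{BwS}_i=\mathrm{AnS}_i=1$, set both to $0$; then, if $\mathrm{BwS}_i=1$ and $\mathrm{Sta}_i>0$, set $\mathrm{BwS}_i$ to $0$ and decrement $\mathrm{Sta}_i$ by $1$. 6. If $\mathrm{Def}_i=\mathrm{AnS}_i=0$ and $\mathrm{Sta}_i>0$, set $\mathrm{AnS}_i$ to $1$ and decrement $\mathrm{Sta}_i$ by $1$. 7. Twice: replace $\mathrm{AnS}_i$ by $\mathrm{AnS}_{i-1}$; then, if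 $\mathrm{AnS}_i=\mathrm{FwS}_i=1$, set both to $0$; then, if $\mathrm{AnS}_i=\mathrm{BwS}_i=1$, set both to $0$. 8. Replace $\mathrm{AnS}_i$ by $\mathrm{AnS}_{i-1}$; then, if $\mathrm{AnS}_i=\mathrm{BwS}_i=1$, set both to $0$. **Theorem.** Let $m\ge 1$, let $\sigma_1<\dots<\sigma_{2m}$ be integers, and put $\Delta:=\sigma_{2m}-\sigma_1$. Let $u^{(0)}$ be the configuration with $\Sigma(u^{(0)})=\{\sigma_1,\dots,\sigma_{2m}\}$ and all other registers zero, and let $u^{(t)}$ be obtained from $u^{(0)}$ by $t$ iterations of the ASR. Then for all $t\ge 0$, $$\Sigma(u^{(t)})\subset[\sigma_1,\sigma_1+\Delta],\qquad \mathrm{supp}(u^{(t)})\subset[\sigma_1,\sigma_1+78\Delta],$$ and for all $t>77\Delta$, $$\mathrm{supp}(u^{(t)})=\varnothing .$$ -/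

import Mathlib

namespace ASR

/-- The registers of one site: the presence of a defect, of a forward-signal, of a
backward-signal and of an anti-signal, and the value of the stack. -/
@[ext]
structure Site where
  dfc : Bool
  fwS : Bool
  bwS : Bool
  anS : Bool
  sta : ℕ

/-- The site all of whose registers are zero. -/
def Site.zero : Site := ⟨false, false, false, false, 0⟩

/-- A configuration of the decoder on the infinite lattice `ℤ`. -/
abbrev Config := ℤ → Site

/-- The set of defects of a configuration. -/
def defects (u : Config) : Set ℤ := {i | (u i).dfc = true}

/-- The set of sites where some register is nonzero. -/
def supp (u : Config) : Set ℤ := {i | u i ≠ Site.zero}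

/-! The phases of one iteration. Each acts in parallel on all the sites; the left and the right
neighbour of site `i` are `i - 1` and `i + 1`. -/

/-- Matching of neighbouring defects. `cor` is the correction register, set where the defect
pattern (left, centre, right) is `(0, 1, 1)`; a defect is removed at the sites with `cor = 1` and
at their right neighbours. -/
def matchDefects (u : Config) : Config :=
  let cor : ℤ → Bool := fun i => !(u (i - 1)).dfc && (u i).dfc && (u (i + 1)).dfc
  fun i => if cor i || cor (i - 1) then { u i with dfc := false } else u i

/-- A defect with no defect on its right, on a site without forward-signal, emits a forward-signal
and increments its stack. -/
def sendForward (u : Config) : Config := fun i =>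
  if (u i).dfc && !(u (i + 1)).dfc && !(u i).fwS then
    { u i with fwS := true, sta := (u i).sta + 1 }
  else u i

/-- Every forward-signal moves one site to the right. -/
def moveForward (u : Config) : Config := fun i => { u i with fwS := (u (i - 1)).fwS }

/-- A forward-signal turns into a backward-signal, provided that the site has no backward-signal
yet. -/
def Site.reflect (s : Site) : Site :=
  if s.fwS && !s.bwS then { s with fwS := false, bwS := true } else s

/-- Correction and signal reflection. `tmp` marks the sites that hold both a defect and a
forward-signal. First each of these loses its defect and reflects its signal; then the site on the
left of each of them receives a defect and reflects its signal, if any. -/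
def correctReflect (u : Config) : Config :=
  let tmp : ℤ → Bool := fun i => (u i).dfc && (u i).fwS
  let v : Config := fun i => if tmp i then { (u i).reflect with dfc := false } else u i
  fun i => if tmp (i + 1) then { (v i).reflect with dfc := true } else v i

/-- Recombination of a backward-signal with an anti-signal. -/
def Site.recombineBwAn (s : Site) : Site :=
  if s.bwS && s.anS then { s with bwS := false, anS := false } else s

/-- Recombination of a backward-signal with a stack increment. -/
def Site.recombineBwSta (s : Site) : Site :=
  if s.bwS && decide (0 < s.sta) then { s with bwS := false, sta := s.sta - 1 } else s

/-- Recombination of a forward-signal with an anti-signal. -/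
def Site.recombineFwAn (s : Site) : Site :=
  if s.fwS && s.anS then { s with fwS := false, anS := false } else s

/-- Every backward-signal moves one site to the left. -/
def moveBackward (u : Config) : Config := fun i => { u i with bwS := (u (i + 1)).bwS }

/-- Every anti-signal moves one site to the right. -/
def moveAnti (u : Config) : Config := fun i => { u i with anS := (u (i - 1)).anS }

/-- One elementary step of the backward-signals: they move by one, then recombine with
anti-signals, then with stacks. -/
def backwardStep (u : Config) : Config := fun i =>
  (moveBackward u i).recombineBwAn.recombineBwSta

/-- A nonempty stack on a site without defect and without anti-signal emits an anti-signal. -/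
def sendAnti (u : Config) : Config := fun i =>
  if !(u i).dfc && !(u i).anS && decide (0 < (u i).sta) then
    { u i with anS := true, sta := (u i).sta - 1 }
  else u i

/-- One elementary step of the anti-signals: they move by one, then recombine with
forward-signals, then with backward-signals. -/
def antiStep (u : Config) : Config := fun i =>
  (moveAnti u i).recombineFwAn.recombineBwAn

/-- The last elementary step of the anti-signals in an iteration: they move by one and recombine
with backward-signals only. -/
def antiLastStep (u : Config) : Config := fun i =>
  (moveAnti u i).recombineBwAn

/-- One iteration of the asymmetric signal-rule, for anti-signals of speed `ka ≥ 1` and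
backward-signals of speed `kb`. -/
def iteration (ka kb : ℕ) (u : Config) : Config :=
  let u₁ := correctReflect (moveForward (sendForward (matchDefects u)))
  let u₂ := sendAnti (backwardStep^[kb] u₁)
  antiLastStep (antiStep^[ka - 1] u₂)

/-- The configuration with set of defects `S` and all the other registers zero. -/
def initial (S : Finset ℤ) : Config := fun i => { Site.zero with dfc := decide (i ∈ S) }

/-- The configuration at time `t` of the asymmetric signal-rule, with both speeds equal to `3`,
started from the set of defects `S` with all the other registers zero. -/
def evolution (S : Finset ℤ) (t : ℕ) : Config := (iteration 3 3)^[t] (initial S)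

end ASR

/-! Stack increments and anti-signals ("debts") carry charge +1, forward- and backward-signals
charge −1. Emission, reflection and recombination conserve the charge of a site, so the cumulated
charge, or height, changes at a site only through signals crossing the bond on its right: a
forward-signal raises it by one, a backward- or anti-signal lowers it by one. The height stays
nonnegative and vanishes just left of every defect (`Inv`, preserved by `Inv.rest`). Hence the debts
between two bonds of zero height equal the signals there in number, at most two per site. Defects
never move right, and nothing outruns the forward-signals, so after `t` iterations the support lies
in `[lo, hi + t]`.

The defects disappear because of a front `q` moving right. Behind it (`Behind`) every site between a
defect of odd rank and the next one holds a forward-signal, and other sites hold none; so each even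
defect is hit and moves left in every iteration, and its own anti-signal kills the forward-signal it
leaves behind (`Inv.self_kill`). In an even gap the front advances freely. In an odd gap it can be
delayed only by a debt at the front, which is spent by the delay. The potential in `Front` drops by
at least one per iteration (`Front.match`, `Front.rest`), so the front passes `hi` within `5 * (hi -
lo)` iterations. From then on the number of odd sites strictly decreases until it is zero
(`Behind.oddCount_lt`), and at time `6 * (hi - lo)` no defect is left.

Without defects the stacks empty from left to right, one unit or one site per iteration. Then the
region free of anti-signals grows at speed 3 and overtakes the support, which grows at speed 1. A
configuration of nonnegative height without defects and debts is empty (`Inv.eq_zero`). -/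

namespace ASR

/-- The charge of a site: stack increments and anti-signals count positively, forward- and
backward-signals negatively. -/
def charge (s : Site) : ℤ := s.sta + s.anS.toInt - s.fwS.toInt - s.bwS.toInt

/-- `hits u i` holds if the defect at `i` meets a forward-signal during the next iteration. -/
def hits (u : Config) (i : ℤ) : Bool := (u i).dfc && (sendForward u (i - 1)).fwS

/-! ### Registers and charge through the phases of an iteration -/

section Fields
variable (u : Config) (i : ℤ)

lemma sendForward_dfc : (sendForward u i).dfc = (u i).dfc := by
  simp only [sendForward]; split_ifs <;> rfl
lemma sendForward_bwS : (sendForward u i).bwS = (u i).bwS := by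
  simp only [sendForward]; split_ifs <;> rfl
lemma sendForward_anS : (sendForward u i).anS = (u i).anS := by
  simp only [sendForward]; split_ifs <;> rfl
lemma sendForward_fwS :
    (sendForward u i).fwS = ((u i).fwS || ((u i).dfc && !(u (i + 1)).dfc)) := by
  simp only [sendForward]; split_ifs <;> grind
lemma sendForward_sta : (sendForward u i).sta =
    if (u i).dfc && !(u (i + 1)).dfc && !(u i).fwS then (u i).sta + 1 else (u i).sta := by
  simp only [sendForward]; split_ifs <;> rfl
lemma charge_sendForward : charge (sendForward u i) = charge (u i) := by
  simp only [sendForward]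
  split_ifs with h
  · have : (u i).fwS = false := by grind
    simp [charge, this]; ring
  · rfl

/-- The configuration after correction and reflection. -/
def reflected (u : Config) : Config := correctReflect (moveForward (sendForward u))

lemma reflected_dfc :
    (reflected u i).dfc = (hits u (i + 1) || ((u i).dfc && !hits u i)) := by
  simp only [reflected, correctReflect, moveForward, hits, Site.reflect, sendForward_dfc]
  grind
lemma reflected_fwS : (reflected u i).fwS =
    ((sendForward u (i - 1)).fwS && ((u i).bwS || !(hits u i || hits u (i + 1)))) := by
  simp only [reflected, correctReflect, moveForward, hits, Site.reflect, sendForward_dfc,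
    sendForward_bwS]
  grind
lemma reflected_bwS : (reflected u i).bwS =
    ((u i).bwS || ((sendForward u (i - 1)).fwS && (hits u i || hits u (i + 1)))) := by
  simp only [reflected, correctReflect, moveForward, hits, Site.reflect, sendForward_dfc,
    sendForward_bwS]
  grind
lemma reflected_anS : (reflected u i).anS = (u i).anS := by
  have h := sendForward_anS u i
  simp only [reflected, correctReflect, moveForward, Site.reflect, sendForward_dfc,
    sendForward_bwS]
  grind
lemma reflected_sta : (reflected u i).sta = (sendForward u i).sta := by
  simp only [reflected, correctReflect, moveForward, Site.reflect, sendForward_dfc,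
    sendForward_bwS]
  grind

lemma backwardStep_dfc : (backwardStep u i).dfc = (u i).dfc := by
  simp only [backwardStep, moveBackward, Site.recombineBwAn, Site.recombineBwSta]; grind
lemma backwardStep_fwS : (backwardStep u i).fwS = (u i).fwS := by
  simp only [backwardStep, moveBackward, Site.recombineBwAn, Site.recombineBwSta]; grind
lemma backwardStep_bwS : (backwardStep u i).bwS =
    ((u (i + 1)).bwS && !(u i).anS && decide ((u i).sta = 0)) := by
  simp only [backwardStep, moveBackward, Site.recombineBwAn, Site.recombineBwSta]; grind
lemma backwardStep_anS : (backwardStep u i).anS = ((u i).anS && !(u (i + 1)).bwS) := by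
  simp only [backwardStep, moveBackward, Site.recombineBwAn, Site.recombineBwSta]; grind
lemma backwardStep_sta : (backwardStep u i).sta =
    if (u (i + 1)).bwS && !(u i).anS then (u i).sta - 1 else (u i).sta := by
  simp only [backwardStep, moveBackward, Site.recombineBwAn, Site.recombineBwSta]; grind

lemma sendAnti_dfc : (sendAnti u i).dfc = (u i).dfc := by simp only [sendAnti]; grind
lemma sendAnti_fwS : (sendAnti u i).fwS = (u i).fwS := by simp only [sendAnti]; grind
lemma sendAnti_bwS : (sendAnti u i).bwS = (u i).bwS := by simp only [sendAnti]; grind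
lemma sendAnti_anS : (sendAnti u i).anS =
    ((u i).anS || (!(u i).dfc && decide (0 < (u i).sta))) := by simp only [sendAnti]; grind
lemma sendAnti_sta : (sendAnti u i).sta =
    if !(u i).dfc && !(u i).anS then (u i).sta - 1 else (u i).sta := by
  simp only [sendAnti]; grind

lemma antiStep_dfc : (antiStep u i).dfc = (u i).dfc := by
  simp only [antiStep, moveAnti, Site.recombineBwAn, Site.recombineFwAn]; grind
lemma antiStep_sta : (antiStep u i).sta = (u i).sta := by
  simp only [antiStep, moveAnti, Site.recombineBwAn, Site.recombineFwAn]; grind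
lemma antiStep_fwS : (antiStep u i).fwS = ((u i).fwS && !(u (i - 1)).anS) := by
  simp only [antiStep, moveAnti, Site.recombineBwAn, Site.recombineFwAn]; grind
lemma antiStep_bwS : (antiStep u i).bwS =
    ((u i).bwS && !((u (i - 1)).anS && !(u i).fwS)) := by
  simp only [antiStep, moveAnti, Site.recombineBwAn, Site.recombineFwAn]; grind
lemma antiStep_anS : (antiStep u i).anS =
    ((u (i - 1)).anS && !(u i).fwS && !(u i).bwS) := by
  simp only [antiStep, moveAnti, Site.recombineBwAn, Site.recombineFwAn]; grind

lemma antiLastStep_dfc : (antiLastStep u i).dfc = (u i).dfc := by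
  simp only [antiLastStep, moveAnti, Site.recombineBwAn]; grind
lemma antiLastStep_sta : (antiLastStep u i).sta = (u i).sta := by
  simp only [antiLastStep, moveAnti, Site.recombineBwAn]; grind
lemma antiLastStep_fwS : (antiLastStep u i).fwS = (u i).fwS := by
  simp only [antiLastStep, moveAnti, Site.recombineBwAn]; grind
lemma antiLastStep_bwS : (antiLastStep u i).bwS = ((u i).bwS && !(u (i - 1)).anS) := by
  simp only [antiLastStep, moveAnti, Site.recombineBwAn]; grind
lemma antiLastStep_anS : (antiLastStep u i).anS = ((u (i - 1)).anS && !(u i).bwS) := by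
  simp only [antiLastStep, moveAnti, Site.recombineBwAn]; grind

lemma charge_backwardStep : charge (backwardStep u i) =
    charge (u i) + (u i).bwS.toInt - (u (i + 1)).bwS.toInt := by
  simp only [charge, backwardStep_sta, backwardStep_anS, backwardStep_fwS, backwardStep_bwS]
  rcases h : (u i).sta with _ | n <;> cases (u i).anS <;> cases (u (i + 1)).bwS <;>
    simp <;> ring
lemma charge_sendAnti : charge (sendAnti u i) = charge (u i) := by
  simp only [charge, sendAnti_sta, sendAnti_anS, sendAnti_fwS, sendAnti_bwS]
  rcases h : (u i).sta with _ | n <;> cases (u i).anS <;> cases (u i).dfc <;> simp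
lemma charge_antiStep : charge (antiStep u i) =
    charge (u i) - (u i).anS.toInt + (u (i - 1)).anS.toInt := by
  simp only [charge, antiStep_sta, antiStep_anS, antiStep_fwS, antiStep_bwS]
  cases (u i).fwS <;> cases (u (i - 1)).anS <;> cases (u i).bwS <;> simp <;> ring
lemma charge_antiLastStep : charge (antiLastStep u i) =
    charge (u i) - (u i).anS.toInt + (u (i - 1)).anS.toInt := by
  simp only [charge, antiLastStep_sta, antiLastStep_anS, antiLastStep_fwS, antiLastStep_bwS]
  cases (u (i - 1)).anS <;> cases (u i).bwS <;> simp <;> ring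
-- Emission is neutral and reflection exchanges two signals of equal charge, so only the
-- forward-signals leaving for `i + 1` and arriving from `i - 1` count.
lemma charge_reflected : charge (reflected u i) = charge (u i)
    + (sendForward u i).fwS.toInt - (sendForward u (i - 1)).fwS.toInt := by
  have h := charge_sendForward u i
  simp only [charge, reflected_sta, reflected_anS, reflected_fwS, reflected_bwS,
    sendForward_bwS, sendForward_anS] at h ⊢
  cases (sendForward u (i - 1)).fwS <;> cases (u i).bwS <;> cases hits u i <;>
    cases hits u (i + 1) <;> simp at h ⊢ <;> omega

lemma matchDefects_dfc : (matchDefects u i).dfc = ((u i).dfc &&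
    !((!(u (i - 1)).dfc && (u (i + 1)).dfc) || (!(u (i - 2)).dfc && (u (i - 1)).dfc))) := by
  have e : i - 1 - 1 = i - 2 := by ring
  simp only [matchDefects, sub_add_cancel, e]; grind
lemma matchDefects_fwS : (matchDefects u i).fwS = (u i).fwS := by
  simp only [matchDefects]; split_ifs <;> rfl
lemma matchDefects_bwS : (matchDefects u i).bwS = (u i).bwS := by
  simp only [matchDefects]; split_ifs <;> rfl
lemma matchDefects_anS : (matchDefects u i).anS = (u i).anS := by
  simp only [matchDefects]; split_ifs <;> rfl
lemma matchDefects_sta : (matchDefects u i).sta = (u i).sta := by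
  simp only [matchDefects]; split_ifs <;> rfl
lemma charge_matchDefects : charge (matchDefects u i) = charge (u i) := by
  simp only [charge, matchDefects_sta, matchDefects_anS, matchDefects_fwS, matchDefects_bwS]

end Fields

/-- The configuration after the first elementary step of the backward-signals. -/
def backOne (u : Config) : Config := backwardStep (reflected u)
/-- The configuration after the second elementary step of the backward-signals. -/
def backTwo (u : Config) : Config := backwardStep (backOne u)
/-- The configuration after the third elementary step of the backward-signals. -/
def backThree (u : Config) : Config := backwardStep (backTwo u)
/-- The configuration after the emission of the anti-signals. -/
def emitted (u : Config) : Config := sendAnti (backThree u)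
/-- The configuration after the first elementary step of the anti-signals. -/
def antiOne (u : Config) : Config := antiStep (emitted u)
/-- The configuration after the second elementary step of the anti-signals. -/
def antiTwo (u : Config) : Config := antiStep (antiOne u)
/-- The part of an iteration that follows the matching of neighbouring defects. -/
def rest (u : Config) : Config := antiLastStep (antiTwo u)

lemma iteration_eq (u : Config) : iteration 3 3 u = rest (matchDefects u) := by
  simp only [iteration, Nat.reduceSub, Function.iterate_succ, Function.iterate_zero,
    Function.comp_apply, id_eq]
  rw [rest, antiTwo, antiOne, emitted, backThree, backTwo, backOne, reflected]

end ASR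

/-! ### The height and its invariants -/

namespace ASR

/-- `h` is the cumulated charge of `u`. -/
def IsHeight (h : ℤ → ℤ) (u : Config) : Prop := ∀ i, h i = h (i - 1) + charge (u i)

lemma IsHeight.matchDefects {h : ℤ → ℤ} {u : Config} (H : IsHeight h u) :
    IsHeight h (matchDefects u) := fun i => by rw [charge_matchDefects]; exact H i

lemma IsHeight.reflected {h : ℤ → ℤ} {u : Config} (H : IsHeight h u) :
    IsHeight (fun i => h i + (sendForward u i).fwS.toInt) (reflected u) := fun i => by
  have := H i
  simp only [charge_reflected]; omega

lemma IsHeight.backwardStep {h : ℤ → ℤ} {u : Config} (H : IsHeight h u) :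
    IsHeight (fun i => h i - (u (i + 1)).bwS.toInt) (backwardStep u) := fun i => by
  have := H i
  simp only [charge_backwardStep, sub_add_cancel]; omega

lemma IsHeight.sendAnti {h : ℤ → ℤ} {u : Config} (H : IsHeight h u) :
    IsHeight h (sendAnti u) := fun i => by rw [charge_sendAnti]; exact H i

lemma IsHeight.antiStep {h : ℤ → ℤ} {u : Config} (H : IsHeight h u) :
    IsHeight (fun i => h i - (u i).anS.toInt) (antiStep u) := fun i => by
  have := H i
  simp only [charge_antiStep]; omega

lemma IsHeight.antiLastStep {h : ℤ → ℤ} {u : Config} (H : IsHeight h u) :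
    IsHeight (fun i => h i - (u i).anS.toInt) (antiLastStep u) := fun i => by
  have := H i
  simp only [charge_antiLastStep]; omega

/-- The invariants of the configurations at the end of the iterations: `h` is the height, the
defects, stacks and backward-signals live in `[lo, hi]` and the other signals in `[lo, r]`. -/
structure Inv (lo hi r : ℤ) (u : Config) (h : ℤ → ℤ) : Prop where
  height : IsHeight h u
  nonneg : ∀ i, 0 ≤ h i
  left : ∀ i < lo, u i = Site.zero
  height_left : ∀ i < lo, h i = 0
  height_right : ∀ i, r ≤ i → h i = 0
  bwS_free : ∀ i, (u i).bwS = true → (u i).sta = 0 ∧ (u i).anS = false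
  dfc_height : ∀ i, (u i).dfc = true → h (i - 1) = 0
  dfc_fwS : ∀ i, (u i).dfc = true → (u i).fwS = false
  dfc_bwS : ∀ i, (u i).dfc = true → (u (i - 1)).bwS = false
  dfc_anS : ∀ i, (u i).dfc = true → (u i).anS = false
  dfc_le : ∀ i, (u i).dfc = true → i ≤ hi
  sta_le : ∀ i, 0 < (u i).sta → i ≤ hi
  bwS_le : ∀ i, (u i).bwS = true → i ≤ hi
  fwS_le : ∀ i, (u i).fwS = true → i ≤ r
  le : hi ≤ r

lemma Inv.matchDefects {lo hi r : ℤ} {u : Config} {h : ℤ → ℤ} (I : Inv lo hi r u h) :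
    Inv lo hi r (matchDefects u) h := by
  have hd : ∀ i, (ASR.matchDefects u i).dfc = true → (u i).dfc = true := by
    intro i; rw [matchDefects_dfc]; grind
  refine ⟨I.height.matchDefects, I.nonneg, ?_, I.height_left, I.height_right, ?_, ?_, ?_, ?_, ?_,
    ?_, ?_, ?_, ?_, I.le⟩
  · intro i hi
    have h0 := I.left i hi
    have h1 := matchDefects_dfc u i
    ext <;> simp [matchDefects_fwS, matchDefects_bwS, matchDefects_anS, matchDefects_sta,
      matchDefects_dfc, h0, Site.zero]
  · simpa only [matchDefects_bwS, matchDefects_sta, matchDefects_anS] using I.bwS_free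
  · exact fun i hi => I.dfc_height i (hd i hi)
  · simpa only [matchDefects_fwS] using fun i hi => I.dfc_fwS i (hd i hi)
  · simpa only [matchDefects_bwS] using fun i hi => I.dfc_bwS i (hd i hi)
  · simpa only [matchDefects_anS] using fun i hi => I.dfc_anS i (hd i hi)
  · exact fun i hi => I.dfc_le i (hd i hi)
  · simpa only [matchDefects_sta] using I.sta_le
  · simpa only [matchDefects_bwS] using I.bwS_le
  · simpa only [matchDefects_fwS] using I.fwS_le

section Rest
variable {lo hi r : ℤ} {u : Config} {h : ℤ → ℤ}

/-- The height left of a defect is zero, and a backward-signal, whose site has no debts, would make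
it negative at `i`. -/
lemma Inv.dfc_bwS_self (I : Inv lo hi r u h) {i : ℤ} (hd : (u i).dfc = true) :
    (u i).bwS = false := by
  by_contra hb
  have hb : (u i).bwS = true := by simpa using hb
  obtain ⟨h1, h2⟩ := I.bwS_free i hb
  have h3 := I.height i
  have h4 := I.nonneg i
  rw [I.dfc_height i hd] at h3
  simp [charge, h1, h2, hb, I.dfc_fwS i hd] at h3
  omega

/-- A defect with a defect on its right emits nothing, so the hitting signal was already present at
`i`; by `dfc_fwS` there is then no defect at `i`. -/
lemma Inv.hits_succ (I : Inv lo hi r u h) {i : ℤ} (hh : hits u (i + 1) = true) :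
    (u (i + 1)).dfc = true ∧ (u i).dfc = false ∧ (u i).fwS = true := by
  simp only [hits, add_sub_cancel_right, sendForward_fwS] at hh
  have := I.dfc_fwS i
  grind

lemma hits_of_fwS {i : ℤ} (hd : (u (i + 1)).dfc = true)
    (hf : (u i).fwS = true) : hits u (i + 1) = true := by
  simp [hits, sendForward_fwS, hd, hf]

/-- The height after the reflection. -/
def htRef (h : ℤ → ℤ) (u : Config) (i : ℤ) : ℤ := h i + (sendForward u i).fwS.toInt
/-- The height after one step of the backward-signals. -/
def htOne (h : ℤ → ℤ) (u : Config) (i : ℤ) : ℤ := htRef h u i - (reflected u (i + 1)).bwS.toInt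
/-- The height after two steps of the backward-signals. -/
def htTwo (h : ℤ → ℤ) (u : Config) (i : ℤ) : ℤ := htOne h u i - (backOne u (i + 1)).bwS.toInt
/-- The height after three steps of the backward-signals. -/
def htThree (h : ℤ → ℤ) (u : Config) (i : ℤ) : ℤ := htTwo h u i - (backTwo u (i + 1)).bwS.toInt
/-- The height after one step of the anti-signals. -/
def htAntiOne (h : ℤ → ℤ) (u : Config) (i : ℤ) : ℤ := htThree h u i - (emitted u i).anS.toInt
/-- The height after two steps of the anti-signals. -/
def htAntiTwo (h : ℤ → ℤ) (u : Config) (i : ℤ) : ℤ := htAntiOne h u i - (antiOne u i).anS.toInt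
/-- The height after the iteration. -/
def htRest (h : ℤ → ℤ) (u : Config) (i : ℤ) : ℤ := htAntiTwo h u i - (antiTwo u i).anS.toInt

lemma toInt_nonneg (b : Bool) : 0 ≤ b.toInt := by cases b <;> decide
lemma toInt_le_one (b : Bool) : b.toInt ≤ 1 := by cases b <;> decide
lemma eq_false_of_toInt {b : Bool} (hb : b.toInt ≤ 0) : b = false := by
  cases b
  · rfl
  · exact absurd hb (by decide)

lemma Inv.isHeight_ref (I : Inv lo hi r u h) :
    IsHeight (htRef h u) (reflected u) := I.height.reflected
lemma Inv.isHeight_one (I : Inv lo hi r u h) :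
    IsHeight (htOne h u) (backOne u) := I.isHeight_ref.backwardStep
lemma Inv.isHeight_two (I : Inv lo hi r u h) :
    IsHeight (htTwo h u) (backTwo u) := I.isHeight_one.backwardStep
lemma Inv.isHeight_three (I : Inv lo hi r u h) :
    IsHeight (htThree h u) (backThree u) := I.isHeight_two.backwardStep
lemma Inv.isHeight_emitted (I : Inv lo hi r u h) :
    IsHeight (htThree h u) (emitted u) := I.isHeight_three.sendAnti
lemma Inv.isHeight_antiOne (I : Inv lo hi r u h) :
    IsHeight (htAntiOne h u) (antiOne u) := I.isHeight_emitted.antiStep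
lemma Inv.isHeight_antiTwo (I : Inv lo hi r u h) :
    IsHeight (htAntiTwo h u) (antiTwo u) := I.isHeight_antiOne.antiStep
lemma Inv.isHeight_rest (I : Inv lo hi r u h) :
    IsHeight (htRest h u) (rest u) := I.isHeight_antiTwo.antiLastStep

/-- The site `i + 1` has no debts, so its charge is at most −1 while the height after it is still
nonnegative. This is what lets the signal cross to the left. -/
lemma IsHeight.one_le_of_bwS {h : ℤ → ℤ} {u : Config} (H : IsHeight h u) (N : ∀ i, 0 ≤ h i)
    (F : ∀ i, (u i).bwS = true → (u i).sta = 0 ∧ (u i).anS = false) {i : ℤ}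
    (hb : (u (i + 1)).bwS = true) : 1 ≤ h i := by
  have h1 := H (i + 1)
  have h2 := N (i + 1)
  obtain ⟨h3, h4⟩ := F _ hb
  have h5 := toInt_nonneg (u (i + 1)).fwS
  simp [charge, h3, h4, hb] at h1
  omega

lemma backwardStep_bwS_free (u : Config) (i : ℤ) (hb : (backwardStep u i).bwS = true) :
    (backwardStep u i).sta = 0 ∧ (backwardStep u i).anS = false := by
  rw [backwardStep_bwS] at hb
  rw [backwardStep_sta, backwardStep_anS]
  grind

lemma nonneg_sub_toInt {x : ℤ} {b : Bool} (hx : 0 ≤ x) (hb : b = true → 1 ≤ x) :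
    0 ≤ x - b.toInt := by
  cases b
  · simpa using hx
  · have := hb rfl
    simp; omega

lemma Inv.nonneg_ref (I : Inv lo hi r u h) (i : ℤ) : 0 ≤ htRef h u i :=
  add_nonneg (I.nonneg i) (toInt_nonneg _)

/-- The signal is either an old one, or the reflection of a forward-signal that has just crossed the
bond and raised the height by one. -/
lemma Inv.one_le_ref (I : Inv lo hi r u h) {i : ℤ} (hb : (reflected u (i + 1)).bwS = true) :
    1 ≤ htRef h u i := by
  have h1 := I.nonneg i
  have h2 := toInt_nonneg (sendForward u i).fwS
  rw [reflected_bwS] at hb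
  rw [htRef]
  by_cases h3 : (u (i + 1)).bwS = true
  · have := I.height.one_le_of_bwS I.nonneg I.bwS_free h3
    omega
  · have h4 : (sendForward u i).fwS = true := by
      simp only [add_sub_cancel_right] at hb
      grind
    rw [h4]; simpa using h1

lemma Inv.nonneg_one (I : Inv lo hi r u h) (i : ℤ) : 0 ≤ htOne h u i :=
  nonneg_sub_toInt (I.nonneg_ref i) I.one_le_ref

lemma Inv.one_le_one (I : Inv lo hi r u h) {i : ℤ} (hb : (backOne u (i + 1)).bwS = true) :
    1 ≤ htOne h u i :=
  I.isHeight_one.one_le_of_bwS I.nonneg_one (backwardStep_bwS_free _) hb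

lemma Inv.nonneg_two (I : Inv lo hi r u h) (i : ℤ) : 0 ≤ htTwo h u i :=
  nonneg_sub_toInt (I.nonneg_one i) I.one_le_one

lemma Inv.one_le_two (I : Inv lo hi r u h) {i : ℤ} (hb : (backTwo u (i + 1)).bwS = true) :
    1 ≤ htTwo h u i :=
  I.isHeight_two.one_le_of_bwS I.nonneg_two (backwardStep_bwS_free _) hb

lemma Inv.nonneg_three (I : Inv lo hi r u h) (i : ℤ) : 0 ≤ htThree h u i :=
  nonneg_sub_toInt (I.nonneg_two i) I.one_le_two

lemma emitted_dfc (u : Config) (i : ℤ) : (emitted u i).dfc = (reflected u i).dfc := by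
  simp only [emitted, sendAnti_dfc, backThree, backTwo, backOne, backwardStep_dfc]
lemma rest_dfc (u : Config) (i : ℤ) : (rest u i).dfc = (reflected u i).dfc := by
  simp only [rest, antiLastStep_dfc, antiTwo, antiOne, antiStep_dfc, emitted_dfc]
lemma emitted_fwS (u : Config) (i : ℤ) : (emitted u i).fwS = (reflected u i).fwS := by
  simp only [emitted, sendAnti_fwS, backThree, backTwo, backOne, backwardStep_fwS]
lemma backThree_dfc (u : Config) (i : ℤ) : (backThree u i).dfc = (reflected u i).dfc := by
  simp only [backThree, backTwo, backOne, backwardStep_dfc]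

lemma emitted_bwS_free (u : Config) (i : ℤ) (hb : (emitted u i).bwS = true) :
    (emitted u i).sta = 0 ∧ (emitted u i).anS = false := by
  rw [emitted, sendAnti_bwS] at hb
  have := backwardStep_bwS_free _ _ hb
  rw [emitted, sendAnti_sta, sendAnti_anS]
  have h1 : (backThree u i).sta = 0 := this.1
  have h2 : (backThree u i).anS = false := this.2
  simp [h1, h2]

lemma backwardStep_debt_le (u : Config) (i : ℤ) :
    (backwardStep u i).sta + (backwardStep u i).anS.toNat ≤ (u i).sta + (u i).anS.toNat := by
  rw [backwardStep_sta, backwardStep_anS]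
  cases (u i).anS <;> cases (u (i + 1)).bwS <;> simp

lemma sendAnti_debt (u : Config) (i : ℤ) :
    (sendAnti u i).sta + (sendAnti u i).anS.toNat = (u i).sta + (u i).anS.toNat := by
  rw [sendAnti_sta, sendAnti_anS]
  rcases h : (u i).sta with _ | n <;> cases (u i).anS <;> cases (u i).dfc <;> simp

lemma toNat_eq_zero {b : Bool} : b.toNat = 0 ↔ b = false := by cases b <;> simp

/-- This keeps the height nonnegative when the anti-signals first move. The charge at `i` is
positive unless a forward-signal shares the site and the anti-signal is its only debt; then the unit
of height comes from that forward-signal, which has just entered from `i - 1`. -/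
lemma Inv.one_le_emitted (I : Inv lo hi r u h) {i : ℤ} (ha : (emitted u i).anS = true) :
    1 ≤ htThree h u i := by
  have h1 := I.isHeight_emitted i
  have h2 := I.nonneg_three (i - 1)
  have hb : (emitted u i).bwS = false := by
    by_contra hb
    have := emitted_bwS_free u i (by simpa using hb)
    simp [ha] at this
  simp only [charge, ha, hb, Bool.toInt_true, Bool.toInt_false] at h1
  by_cases hf : (emitted u i).fwS = true
  swap
  · have hf : (emitted u i).fwS = false := by simpa using hf
    rw [hf, Bool.toInt_false] at h1
    omega
  by_cases hs : 0 < (emitted u i).sta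
  · rw [hf, Bool.toInt_true] at h1
    omega
  -- Debts only decrease during the backward steps, so one was present throughout and no
  -- backward-signal survived at `i`: after the first backward step, none crosses the bond `(i - 1,
  -- i)`.
  have hdebt : (emitted u i).sta + (emitted u i).anS.toNat = 1 := by simp [ha]; omega
  have h3 : 1 ≤ (backThree u i).sta + (backThree u i).anS.toNat := by
    rw [← sendAnti_debt]; exact hdebt.ge
  have h4 : 1 ≤ (backTwo u i).sta + (backTwo u i).anS.toNat :=
    h3.trans (backwardStep_debt_le _ _)
  have h5 : 1 ≤ (backOne u i).sta + (backOne u i).anS.toNat :=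
    h4.trans (backwardStep_debt_le _ _)
  have b5 : (backOne u i).bwS = false := by
    by_contra hb
    have hb : (backOne u i).bwS = true := by simpa using hb
    have h6 := backwardStep_bwS_free (reflected u) i hb
    have h7 : (backOne u i).sta = 0 := h6.1
    have h8 : (backOne u i).anS = false := h6.2
    simp [h7, h8] at h5
  have b6 : (backTwo u i).bwS = false := by
    by_contra hb
    have hb : (backTwo u i).bwS = true := by simpa using hb
    have h6 := backwardStep_bwS_free (backOne u) i hb
    have h7 : (backTwo u i).sta = 0 := h6.1
    have h8 : (backTwo u i).anS = false := h6.2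
    simp [h7, h8] at h4
  rw [emitted_fwS, reflected_fwS] at hf
  have f2 : (sendForward u (i - 1)).fwS = true := by grind
  have h9 : htThree h u (i - 1) = h (i - 1) + 1 - (reflected u i).bwS.toInt := by
    simp [htThree, htTwo, htOne, htRef, b5, b6, f2]
  have h10 := I.nonneg (i - 1)
  have h11 : (reflected u i).bwS.toInt ≤ h (i - 1) := by
    by_cases hb0 : (u i).bwS = true
    · have := I.height.one_le_of_bwS I.nonneg I.bwS_free (i := i - 1) (by simpa using hb0)
      exact (toInt_le_one _).trans this
    · have : (reflected u i).bwS = false := by rw [reflected_bwS]; grind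
      simpa [this] using h10
  have h12 := toInt_le_one (emitted u i).fwS
  omega

lemma Inv.nonneg_antiOne (I : Inv lo hi r u h) (i : ℤ) : 0 ≤ htAntiOne h u i :=
  nonneg_sub_toInt (I.nonneg_three i) I.one_le_emitted

lemma IsHeight.one_le_of_anS {h : ℤ → ℤ} {u : Config} (H : IsHeight h u) (N : ∀ i, 0 ≤ h i)
    {i : ℤ} (ha : (u i).anS = true) (hf : (u i).fwS = false) (hb : (u i).bwS = false) :
    1 ≤ h i := by
  have h1 := H i
  have h2 := N (i - 1)
  simp [charge, ha, hf, hb] at h1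
  omega

lemma antiStep_anS_free (u : Config) (i : ℤ) (ha : (antiStep u i).anS = true) :
    (antiStep u i).fwS = false ∧ (antiStep u i).bwS = false := by
  rw [antiStep_anS] at ha
  rw [antiStep_fwS, antiStep_bwS]
  grind

lemma Inv.nonneg_antiTwo (I : Inv lo hi r u h) (i : ℤ) : 0 ≤ htAntiTwo h u i :=
  nonneg_sub_toInt (I.nonneg_antiOne i) fun ha =>
    I.isHeight_antiOne.one_le_of_anS I.nonneg_antiOne ha (antiStep_anS_free _ i ha).1
      (antiStep_anS_free _ i ha).2

lemma Inv.nonneg_rest (I : Inv lo hi r u h) (i : ℤ) : 0 ≤ htRest h u i :=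
  nonneg_sub_toInt (I.nonneg_antiTwo i) fun ha =>
    I.isHeight_antiTwo.one_le_of_anS I.nonneg_antiTwo ha (antiStep_anS_free _ i ha).1
      (antiStep_anS_free _ i ha).2

/-- Once the height left of `i` vanishes, nothing crosses the bond `(i - 1, i)`. -/
lemma Inv.no_crossing_of_two (I : Inv lo hi r u h) {i : ℤ} (hz : htTwo h u (i - 1) ≤ 0) :
    (backTwo u i).bwS = false ∧ (emitted u (i - 1)).anS = false ∧
      (antiOne u (i - 1)).anS = false ∧ (antiTwo u (i - 1)).anS = false ∧
      htThree h u (i - 1) = 0 ∧ htRest h u (i - 1) = 0 := by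
  -- From `htTwo` on the height only decreases, by the crossings listed below; since it ends
  -- nonnegative, all of them vanish.
  have h1 := I.nonneg_rest (i - 1)
  have a1 := toInt_nonneg (emitted u (i - 1)).anS
  have a2 := toInt_nonneg (antiOne u (i - 1)).anS
  have a3 := toInt_nonneg (antiTwo u (i - 1)).anS
  have a4 := toInt_nonneg (backTwo u i).bwS
  have e1 : htThree h u (i - 1) = htTwo h u (i - 1) - (backTwo u i).bwS.toInt := by
    simp [htThree]
  have e2 : htAntiOne h u (i - 1) = htThree h u (i - 1) - (emitted u (i - 1)).anS.toInt := rfl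
  have e3 : htAntiTwo h u (i - 1) = htAntiOne h u (i - 1) - (antiOne u (i - 1)).anS.toInt := rfl
  have e4 : htRest h u (i - 1) = htAntiTwo h u (i - 1) - (antiTwo u (i - 1)).anS.toInt := rfl
  refine ⟨eq_false_of_toInt ?_, eq_false_of_toInt ?_, eq_false_of_toInt ?_,
    eq_false_of_toInt ?_, ?_, ?_⟩ <;> omega

/-- The data at a defect that moves from `i + 1` to `i`. -/
lemma Inv.of_hits (I : Inv lo hi r u h) {i : ℤ} (hh : hits u (i + 1) = true) :
    htTwo h u (i - 1) ≤ 0 ∧ htOne h u i = 0 ∧ (reflected u i).fwS = false ∧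
      (reflected u (i + 1)).fwS = false := by
  obtain ⟨hd, hd0, hf⟩ := I.hits_succ hh
  have hb : (u i).bwS = false := by simpa using I.dfc_bwS _ hd
  have hb1 := I.dfc_bwS_self hd
  have hz : h i = 0 := by simpa using I.dfc_height _ hd
  have f2 : (sendForward u i).fwS = true := by rw [sendForward_fwS, hf]; rfl
  have hni : hits u i = false := by simp [hits, hd0]
  have b4 : (reflected u i).bwS = (sendForward u (i - 1)).fwS := by
    rw [reflected_bwS, hb, hh]; simp
  have b4' : (reflected u (i + 1)).bwS = true := by
    rw [reflected_bwS, hh]; simp [f2]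
  have s4 : (reflected u i).sta = (u i).sta := by
    rw [reflected_sta, sendForward_sta, hd0]; simp
  have h1 := I.height i
  simp only [charge, hz, hf, hb, Bool.toInt_true, Bool.toInt_false] at h1
  have h5 : htOne h u (i - 1) = h (i - 1) := by
    simp [htOne, htRef, b4]
  have h6 : htTwo h u (i - 1) = h (i - 1) - (backOne u i).bwS.toInt := by
    simp [htTwo, h5]
  refine ⟨?_, ?_, ?_, ?_⟩
  -- As `h i = 0` and a forward-signal stands at `i`, `h (i - 1)` is one minus the debts there. If
  -- it equals one, `i` has no debts, so the signal reflected at `i + 1` survives at `i` and crosses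
  -- to `i - 1` in the second backward step.
  · rw [h6]
    have b5 : (backOne u i).bwS = (!(u i).anS && decide ((u i).sta = 0)) := by
      rw [backOne, backwardStep_bwS, b4', s4, reflected_anS]; simp
    rw [b5]
    have := toInt_nonneg (u i).anS
    by_cases hs : (u i).sta = 0
    · cases ha : (u i).anS <;> simp [hs, ha] at h1 ⊢ <;> omega
    · have := toInt_nonneg (!(u i).anS && decide ((u i).sta = 0))
      omega
  · simp [htOne, htRef, hz, f2, b4']
  · rw [reflected_fwS, hb, hh]; simp
  · rw [reflected_fwS, hb1, hh]; simp

/-- The data at a defect that is not hit. -/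
lemma Inv.of_not_hits (I : Inv lo hi r u h) {i : ℤ} (hd : (u i).dfc = true)
    (hh : hits u i = false) : htTwo h u (i - 1) ≤ 0 ∧ (reflected u i).fwS = false := by
  have f2 : (sendForward u (i - 1)).fwS = false := by
    simpa [hits, hd] using hh
  constructor
  · have a1 := toInt_nonneg (reflected u i).bwS
    have a2 := toInt_nonneg (backOne u i).bwS
    simp [htTwo, htOne, htRef, f2, I.dfc_height i hd]
    omega
  · rw [reflected_fwS, f2]; rfl

lemma Inv.of_reflected_dfc (I : Inv lo hi r u h) {i : ℤ} (hd : (reflected u i).dfc = true) :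
    htTwo h u (i - 1) ≤ 0 ∧ (reflected u i).fwS = false := by
  rw [reflected_dfc] at hd
  by_cases hh : hits u (i + 1) = true
  · have := I.of_hits hh
    exact ⟨this.1, this.2.2.1⟩
  · exact I.of_not_hits (by grind) (by grind)

end Rest
end ASR

/-! ### Preservation of the invariants -/

namespace ASR
section Rest
variable {lo hi r : ℤ} {u : Config} {h : ℤ → ℤ}

lemma rest_sta (u : Config) (i : ℤ) : (rest u i).sta = (emitted u i).sta := by
  simp only [rest, antiLastStep_sta, antiTwo, antiOne, antiStep_sta]

lemma rest_fwS (u : Config) (i : ℤ) : (rest u i).fwS =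
    ((reflected u i).fwS && !(emitted u (i - 1)).anS && !(antiOne u (i - 1)).anS) := by
  rw [rest, antiLastStep_fwS, antiTwo, antiStep_fwS, antiOne, antiStep_fwS, emitted_fwS]

lemma backThree_debt_le (u : Config) (i : ℤ) :
    (backThree u i).sta + (backThree u i).anS.toNat ≤
      (sendForward u i).sta + (u i).anS.toNat := by
  rw [← reflected_sta, ← reflected_anS u]
  exact (backwardStep_debt_le _ _).trans
    ((backwardStep_debt_le _ _).trans (backwardStep_debt_le _ _))

lemma emitted_debt (u : Config) (i : ℤ) :
    (emitted u i).sta + (emitted u i).anS.toNat =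
      (backThree u i).sta + (backThree u i).anS.toNat := sendAnti_debt _ _

lemma emitted_debt_le (u : Config) (i : ℤ) :
    (emitted u i).sta + (emitted u i).anS.toNat ≤ (sendForward u i).sta + (u i).anS.toNat :=
  (emitted_debt u i).trans_le (backThree_debt_le u i)

lemma sendForward_sta_of_not_dfc {i : ℤ} (hd : (u i).dfc = false) :
    (sendForward u i).sta = (u i).sta := by
  rw [sendForward_sta, hd]; simp

lemma sendForward_fwS_of_not_dfc {i : ℤ} (hd : (u i).dfc = false) :
    (sendForward u i).fwS = (u i).fwS := by
  rw [sendForward_fwS, hd]; simp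

lemma emitted_anS_of_debt {i : ℤ} (hd : (reflected u i).dfc = false)
    (hs : 1 ≤ (backThree u i).sta + (backThree u i).anS.toNat) : (emitted u i).anS = true := by
  rw [emitted, sendAnti_anS, backThree_dfc, hd]
  cases ha : (backThree u i).anS
  · simp [ha] at hs ⊢; omega
  · rfl

lemma emitted_anS_of_dfc {i : ℤ} (hd : (reflected u i).dfc = true)
    (ha : (u i).anS = false) : (emitted u i).anS = false := by
  have h7 : (backThree u i).anS = false := by
    simp [backThree, backTwo, backOne, backwardStep_anS, reflected_anS, ha]
  simp [emitted, sendAnti_anS, backThree_dfc, hd, h7]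

lemma antiOne_anS_imp {i : ℤ} (ha : (antiOne u i).anS = true) :
    (emitted u (i - 1)).anS = true := by
  rw [antiOne, antiStep_anS] at ha; grind

lemma antiTwo_anS_imp {i : ℤ} (ha : (antiTwo u i).anS = true) :
    (antiOne u (i - 1)).anS = true := by
  rw [antiTwo, antiStep_anS] at ha; grind

lemma rest_anS_imp {i : ℤ} (ha : (rest u i).anS = true) : (antiTwo u (i - 1)).anS = true := by
  rw [rest, antiLastStep_anS] at ha; grind

lemma rest_bwS_imp {i : ℤ} (hb : (rest u i).bwS = true) : (emitted u i).bwS = true := by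
  rw [rest, antiLastStep_bwS, antiTwo, antiStep_bwS, antiOne, antiStep_bwS] at hb
  grind

lemma emitted_bwS_imp {i : ℤ} (hb : (emitted u i).bwS = true) :
    (backTwo u (i + 1)).bwS = true := by
  rw [emitted, sendAnti_bwS, backThree, backwardStep_bwS] at hb; grind

lemma backTwo_bwS_imp {i : ℤ} (hb : (backTwo u i).bwS = true) :
    (backOne u (i + 1)).bwS = true := by
  rw [backTwo, backwardStep_bwS] at hb; grind

lemma backOne_bwS_imp {i : ℤ} (hb : (backOne u i).bwS = true) :
    (reflected u (i + 1)).bwS = true := by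
  rw [backOne, backwardStep_bwS] at hb; grind

lemma htRest_le (i : ℤ) : htRest h u i ≤ htRef h u i := by
  have a1 := toInt_nonneg (emitted u i).anS
  have a2 := toInt_nonneg (antiOne u i).anS
  have a3 := toInt_nonneg (antiTwo u i).anS
  have a4 := toInt_nonneg (backTwo u (i + 1)).bwS
  have a5 := toInt_nonneg (backOne u (i + 1)).bwS
  have a6 := toInt_nonneg (reflected u (i + 1)).bwS
  simp only [htRest, htAntiTwo, htAntiOne, htThree, htTwo, htOne]
  omega

lemma Inv.rest_left (I : Inv lo hi r u h) {i : ℤ} (hi : i < lo) : rest u i = Site.zero := by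
  have z : ∀ j < lo, (u j).dfc = false ∧ (u j).fwS = false ∧ (u j).bwS = false ∧
      (u j).anS = false ∧ (u j).sta = 0 := by
    intro j hj; rw [I.left j hj]; simp [Site.zero]
  have hd : (rest u i).dfc = false := by
    rw [rest_dfc]
    by_contra hc
    have hc : (reflected u i).dfc = true := by simpa using hc
    rw [reflected_dfc, (z i hi).1] at hc
    have := I.hits_succ (i := i) (by simpa using hc)
    rw [(z i hi).2.1] at this
    simp at this
  have a8 : ∀ j < lo, (emitted u j).sta = 0 ∧ (emitted u j).anS = false := by
    intro j hj
    have h1 := emitted_debt_le u j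
    rw [sendForward_sta_of_not_dfc (z j hj).1, (z j hj).2.2.2.1, (z j hj).2.2.2.2] at h1
    simp at h1
    exact h1
  have f3 : (reflected u i).fwS = false := by
    rw [reflected_fwS, sendForward_fwS_of_not_dfc (z _ (by omega)).1, (z _ (by omega)).2.1]; rfl
  have hr : htRef h u i = 0 := by
    rw [htRef, I.height_left i hi, sendForward_fwS_of_not_dfc (z i hi).1, (z i hi).2.1]; rfl
  have ha : (rest u i).anS = false := by
    by_contra hc
    have h1 := antiOne_anS_imp (antiTwo_anS_imp (rest_anS_imp (by simpa using hc)))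
    rw [(a8 _ (by omega)).2] at h1
    simp at h1
  -- Such a signal would have crossed a bond of height at least one, whereas the height left of `lo`
  -- is zero.
  have hb : (rest u i).bwS = false := by
    by_contra hc
    have h1 := emitted_bwS_imp (rest_bwS_imp (u := u) (i := i) (by simpa using hc))
    have h2 := I.one_le_two h1
    have a5 := toInt_nonneg (backOne u (i + 1)).bwS
    have a6 := toInt_nonneg (reflected u (i + 1)).bwS
    simp only [htTwo, htOne, hr] at h2
    omega
  ext
  · exact hd
  · rw [rest_fwS, f3]; rfl
  · exact hb
  · exact ha
  · rw [rest_sta]; exact (a8 i hi).1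

/-- Every defect present afterwards has zero height on its left already after two backward steps, so
nothing crosses that bond later: this gives all the conditions at defects. The bound `r` grows by
one, the speed of the forward-signals. -/
theorem Inv.rest (I : Inv lo hi r u h) : Inv lo hi (r + 1) (rest u) (htRest h u) := by
  have cross : ∀ i, (ASR.rest u i).dfc = true → (reflected u i).fwS = false ∧
      (backTwo u i).bwS = false ∧ (antiTwo u (i - 1)).anS = false ∧ htRest h u (i - 1) = 0 := by
    intro i hd
    rw [rest_dfc] at hd
    obtain ⟨h1, h2⟩ := I.of_reflected_dfc hd
    obtain ⟨h3, -, -, h4, -, h5⟩ := I.no_crossing_of_two h1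
    exact ⟨h2, h3, h4, h5⟩
  have f2le : ∀ i, (sendForward u i).fwS = true → i ≤ r := by
    intro i hf
    rw [sendForward_fwS] at hf
    have h1 := I.fwS_le i
    have h2 := I.dfc_le i
    have h3 := I.le
    by_cases hc : (u i).fwS = true
    · exact h1 hc
    · exact (h2 (by grind)).trans h3
  refine ⟨I.isHeight_rest, I.nonneg_rest, fun i hi => I.rest_left hi, ?_, ?_, ?_, ?_, ?_, ?_, ?_,
    ?_, ?_, ?_, ?_, ?_⟩
  · intro i hi
    refine le_antisymm ((htRest_le i).trans ?_) (I.nonneg_rest i)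
    rw [htRef, I.height_left i hi, sendForward_fwS, I.left i hi]
    simp [Site.zero]
  · intro i hi
    refine le_antisymm ((htRest_le i).trans ?_) (I.nonneg_rest i)
    have : (sendForward u i).fwS = false := by
      by_contra hc
      have := f2le i (by simpa using hc)
      omega
    rw [htRef, I.height_right i (by omega), this]; rfl
  · intro i hb
    have h1 := emitted_bwS_free u i (rest_bwS_imp hb)
    rw [rest_sta]
    refine ⟨h1.1, ?_⟩
    rw [ASR.rest, antiLastStep_bwS] at hb
    rw [ASR.rest, antiLastStep_anS]
    grind
  · exact fun i hd => (cross i hd).2.2.2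
  · intro i hd
    rw [rest_fwS, (cross i hd).1]; rfl
  · intro i hd
    by_contra hc
    have h1 := emitted_bwS_imp (rest_bwS_imp (u := u) (i := i - 1) (by simpa using hc))
    rw [sub_add_cancel, (cross i hd).2.1] at h1
    simp at h1
  · intro i hd
    by_contra hc
    have h1 := rest_anS_imp (u := u) (i := i) (by simpa using hc)
    rw [(cross i hd).2.2.1] at h1
    simp at h1
  · intro i hd
    rw [rest_dfc, reflected_dfc] at hd
    by_cases hh : hits u (i + 1) = true
    · have := I.dfc_le _ (I.hits_succ hh).1
      omega
    · exact I.dfc_le i (by grind)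
  · intro i hs
    have h1 := emitted_debt_le u i
    rw [rest_sta] at hs
    by_cases hd : (u i).dfc = true
    · exact I.dfc_le i hd
    · have hd : (u i).dfc = false := by simpa using hd
      rw [sendForward_sta_of_not_dfc hd] at h1
      by_cases h0 : 0 < (u i).sta
      · exact I.sta_le i h0
      · have ha : (u i).sta = 0 := by omega
        exfalso
        -- Off the defects stacks never grow, so a stack can become nonempty only at a defect.
        have h3 : (backThree u i).sta = 0 := by
          have : (reflected u i).sta = 0 := by
            rw [reflected_sta, sendForward_sta_of_not_dfc hd, ha]
          simp [backThree, backTwo, backOne, backwardStep_sta, this]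
        simp [emitted, sendAnti_sta, h3] at hs
  · intro i hb
    have h1 := backOne_bwS_imp (backTwo_bwS_imp (emitted_bwS_imp (rest_bwS_imp hb)))
    rw [reflected_bwS] at h1
    have e1 := I.bwS_le (i + 1 + 1 + 1)
    have e2 := I.dfc_le (i + 1 + 1 + 1)
    have e3 := I.dfc_le (i + 1 + 1 + 1 + 1)
    simp only [hits] at h1
    by_cases c1 : (u (i + 1 + 1 + 1)).bwS = true
    · have := e1 c1; omega
    · by_cases c2 : (u (i + 1 + 1 + 1)).dfc = true
      · have := e2 c2; omega
      · have := e3 (by grind); omega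
  · intro i hf
    rw [rest_fwS, reflected_fwS] at hf
    have := f2le (i - 1) (by grind)
    omega
  · have := I.le; omega

/-- A defect that is hit leaves no forward-signal behind. -/
theorem Inv.self_kill (I : Inv lo hi r u h) {i : ℤ} (hh : hits u i = true) :
    (ASR.rest u (i + 1)).fwS = false := by
  by_contra hc
  have hc : (ASR.rest u (i + 1)).fwS = true := by simpa using hc
  rw [rest_fwS] at hc
  simp only [add_sub_cancel_right] at hc
  have hf : (reflected u (i + 1)).fwS = true := by grind
  have ha : (emitted u i).anS = false := by grind
  have hd : (u i).dfc = true := by simp only [hits] at hh; grind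
  have hn : hits u (i + 1) = false := by
    by_contra hc
    have := I.hits_succ (i := i) (by simpa using hc)
    simp [hd] at this
  have hd4 : (reflected u i).dfc = false := by
    rw [reflected_dfc, hn, hh]; simp
  have hh' : hits u (i - 1 + 1) = true := by simpa using hh
  obtain ⟨-, ho, -, hf4⟩ := I.of_hits hh'
  rw [sub_add_cancel] at hf4
  -- The defect has left `i`, so any debt there would emit an anti-signal that kills the
  -- forward-signal at `i + 1`. Yet the stack at `i` has just been incremented; it remains to see
  -- that no backward-signal consumed it.
  have debt0 : (backThree u i).sta + (backThree u i).anS.toNat = 0 := by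
    by_contra hne
    have := emitted_anS_of_debt hd4 (by omega)
    simp [ha] at this
  have f2 : (sendForward u i).fwS = true := by
    rw [reflected_fwS] at hf; simp only [add_sub_cancel_right] at hf; grind
  have s4 : (reflected u i).sta = (u i).sta + 1 := by
    rw [reflected_sta, sendForward_sta]
    rw [sendForward_fwS] at f2
    have := I.dfc_fwS i hd
    grind
  have b4 : (reflected u (i + 1)).bwS = (u (i + 1)).bwS := by
    rw [reflected_fwS] at hf
    rw [reflected_bwS]
    grind
  -- the height at `i` is at least one, unless the debts at `i + 1` are positive
  have z1 : htThree h u (i - 1) ≤ 0 := by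
    have a4 := toInt_nonneg (backTwo u i).bwS
    have a5 := toInt_nonneg (backOne u i).bwS
    simp only [htThree, htTwo, ho, sub_add_cancel]
    omega
  have z2 := I.isHeight_three i
  have z3 := I.isHeight_three (i + 1)
  have z4 := I.nonneg_three (i + 1)
  have f7 : (backThree u (i + 1)).fwS = true := by
    simpa [backThree, backTwo, backOne, backwardStep_fwS] using hf
  have a0 : (backThree u i).anS = false := toNat_eq_zero.1 (by omega)
  have s0 : (backThree u i).sta = 0 := by omega
  have a7 := toInt_nonneg (backThree u (i + 1)).bwS
  have a8 := toInt_nonneg (backThree u i).bwS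
  have a9 := toInt_nonneg (backThree u i).fwS
  simp only [add_sub_cancel_right, charge, f7, s0, a0, Bool.toInt_true, Bool.toInt_false,
    Nat.cast_zero] at z2 z3
  have e1 : 1 ≤ (backThree u (i + 1)).sta + (backThree u (i + 1)).anS.toNat := by
    cases hq : (backThree u (i + 1)).anS <;> simp [hq] at z3 ⊢ <;> omega
  have e2 := e1.trans (backwardStep_debt_le _ _)
  have e3 := e2.trans (backwardStep_debt_le _ _)
  have e4 := e3.trans (backwardStep_debt_le _ _)
  -- The debt at `i + 1`, present at every backward step, excludes a backward-signal there, hence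
  -- also any decrement at `i`.
  have c4 : (reflected u (i + 1)).bwS = false := by
    by_contra hb
    have hb : (u (i + 1)).bwS = true := by rw [← b4]; simpa using hb
    have h1 := I.bwS_free _ hb
    have hdn : (u (i + 1)).dfc = false := by
      by_contra hdn
      have := I.dfc_bwS_self (i := i + 1) (by simpa using hdn)
      simp [hb] at this
    rw [reflected_sta, reflected_anS, sendForward_sta_of_not_dfc hdn, h1.1, h1.2] at e4
    simp at e4
  have c5 : (backOne u (i + 1)).bwS = false := by
    by_contra hb
    have hb : (backOne u (i + 1)).bwS = true := by simpa using hb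
    have h1 : (backOne u (i + 1)).sta = 0 ∧ (backOne u (i + 1)).anS = false :=
      backwardStep_bwS_free _ _ hb
    rw [h1.1, h1.2] at e3
    simp at e3
  have c6 : (backTwo u (i + 1)).bwS = false := by
    by_contra hb
    have hb : (backTwo u (i + 1)).bwS = true := by simpa using hb
    have h1 : (backTwo u (i + 1)).sta = 0 ∧ (backTwo u (i + 1)).anS = false :=
      backwardStep_bwS_free _ _ hb
    rw [h1.1, h1.2] at e2
    simp at e2
  have : (backThree u i).sta = (u i).sta + 1 := by
    rw [backThree, backwardStep_sta, c6, backTwo, backwardStep_sta, c5, backOne,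
      backwardStep_sta, c4, s4]
    simp
  omega

end Rest
end ASR

/-! ### Parity of the defects and the structure behind the front -/

namespace ASR

/-- `c i` is the parity of the number of defects at the sites `≤ i`. -/
structure Par (lo hi : ℤ) (u : Config) (c : ℤ → Bool) : Prop where
  step : ∀ i, c i = (c (i - 1) ^^ (u i).dfc)
  left : ∀ i < lo, c i = false
  right : ∀ i, hi ≤ i → c i = false

/-- `cor u i` holds if the defects at `i` and `i + 1` are matched. -/
def cor (u : Config) (i : ℤ) : Bool := !(u (i - 1)).dfc && (u i).dfc && (u (i + 1)).dfc

/-- The parity after the matching. -/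
def parMatch (u : Config) (c : ℤ → Bool) (i : ℤ) : Bool := c i ^^ cor u i
/-- The parity after the rest of the iteration. -/
def parRest (u : Config) (c : ℤ → Bool) (i : ℤ) : Bool := c i ^^ hits u (i + 1)

lemma matchDefects_dfc_eq (u : Config) (i : ℤ) :
    (matchDefects u i).dfc = ((u i).dfc && !cor u i && !cor u (i - 1)) := by
  have e : i - 1 - 1 = i - 2 := by ring
  rw [matchDefects_dfc, cor, cor, e, sub_add_cancel]
  grind

section
variable {lo hi r : ℤ} {u : Config} {h : ℤ → ℤ} {c : ℤ → Bool}

/-- Removing the adjacent defects `i` and `i + 1` flips the parity at `i` only. -/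
lemma Par.match (P : Par lo hi u c) (I : Inv lo hi r u h) :
    Par lo hi (matchDefects u) (parMatch u c) := by
  refine ⟨fun i => ?_, fun i hl => ?_, fun i hr => ?_⟩
  · have h1 := P.step i
    have e : i - 1 - 1 = i - 2 := by ring
    simp only [parMatch, matchDefects_dfc_eq, cor, e, sub_add_cancel] at h1 ⊢
    grind
  · have : (u i).dfc = false := by rw [I.left i hl]; rfl
    simp [parMatch, P.left i hl, cor, this]
  · have : (u (i + 1)).dfc = false := by
      by_contra hc
      have := I.dfc_le (i + 1) (by simpa using hc)
      omega
    simp [parMatch, P.right i hr, cor, this]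

/-- Moving a defect from `i + 1` to `i` flips the parity at `i` only. -/
lemma Par.rest (P : Par lo hi u c) (I : Inv lo hi r u h) :
    Par lo hi (rest u) (parRest u c) := by
  refine ⟨fun i => ?_, fun i hl => ?_, fun i hr => ?_⟩
  · have h1 := P.step i
    have h2 : hits u (i + 1) = true → (u i).dfc = false := fun hh => (I.hits_succ hh).2.1
    have h3 : hits u i = true → (u i).dfc = true := by
      intro hh; simp only [hits] at hh; grind
    simp only [parRest, rest_dfc, reflected_dfc, sub_add_cancel]
    grind
  · have h1 : hits u (i + 1) = false := by
      by_contra hc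
      have := (I.hits_succ (i := i) (by simpa using hc)).2.2
      rw [I.left i hl] at this
      simp [Site.zero] at this
    simp [parRest, P.left i hl, h1]
  · have h1 : hits u (i + 1) = false := by
      by_contra hc
      have := I.dfc_le _ (I.hits_succ (i := i) (by simpa using hc)).1
      omega
    simp [parRest, P.right i hr, h1]

/-- The structure of a configuration behind the front `q`: between a defect of odd rank and the
next one every site holds a forward-signal and, except at the front, neither a stack nor an
anti-signal; elsewhere there is no forward-signal. -/
structure Behind (u : Config) (c : ℤ → Bool) (q : ℤ) : Prop where
  one : ∀ i ≤ q, c i = true → (u i).dfc = false → (u i).fwS = true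
  clean : ∀ i < q, c i = true → (u i).dfc = false → (u i).sta = 0 ∧ (u i).anS = false
  zero : ∀ i ≤ q, c i = false → (u i).fwS = false
  sep : ∀ i, i + 1 ≤ q → (u i).dfc = true → (u (i + 1)).dfc = true → c i = true

lemma Behind.extend {q : ℤ} (B : Behind u c q)
    (hclean : c q = true → (u q).dfc = false → (u q).sta = 0 ∧ (u q).anS = false)
    (hone : c (q + 1) = true → (u (q + 1)).dfc = false → (u (q + 1)).fwS = true)
    (hzero : c (q + 1) = false → (u (q + 1)).fwS = false)
    (hsep : (u q).dfc = true → (u (q + 1)).dfc = true → c q = true) : Behind u c (q + 1) := by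
  refine ⟨fun i hi => ?_, fun i hi => ?_, fun i hi => ?_, fun i hi => ?_⟩
  · rcases hi.lt_or_eq with h1 | rfl
    · exact B.one i (by omega)
    · exact hone
  · rcases (show i ≤ q by omega).lt_or_eq with h1 | rfl
    · exact B.clean i h1
    · exact hclean
  · rcases hi.lt_or_eq with h1 | rfl
    · exact B.zero i (by omega)
    · exact hzero
  · rcases (show i ≤ q by omega).lt_or_eq with h1 | rfl
    · exact B.sep i h1
    · exact hsep

/-- The front after the matching. -/
def frontMatch (u : Config) (c : ℤ → Bool) (q : ℤ) : ℤ :=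
  -- A matched pair may straddle the front. If `q` is odd, the gap closes and the front passes the
  -- pair. If `q` is even, its removal reopens the odd gap to its left beyond the sites already
  -- filled, and the front retreats.
  if cor u q then (if c q then q + 1 else q - 1) else q

/-- An adjacent pair survives the matching only if preceded by two more defects; then `sep` would
make two consecutive defects both odd. -/
lemma Behind.match_noAdj {q : ℤ} (B : Behind u c q) (P : Par lo hi u c) (i : ℤ)
    (hi : i ≤ frontMatch u c q) (hd : (matchDefects u i).dfc = true) :
    (matchDefects u (i + 1)).dfc = false := by
  by_contra hd1
  have hd1 : (matchDefects u (i + 1)).dfc = true := by simpa using hd1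
  rw [matchDefects_dfc_eq] at hd hd1
  rw [add_sub_cancel_right] at hd1
  have hiq : i ≤ q := by
    by_contra hlt
    have h1 : cor u q = true ∧ i = q + 1 := by
      unfold frontMatch at hi; split_ifs at hi <;> first | omega | exact ⟨‹_›, by omega⟩
    obtain ⟨h1, rfl⟩ := h1
    rw [add_sub_cancel_right, h1] at hd
    simp at hd
  have e : i - 1 - 1 = i - 2 := by ring
  have n1 : (u (i - 1)).dfc = true := by simp only [cor] at hd hd1; grind
  have n2 : (u (i - 2)).dfc = true := by
    simp only [cor, e, sub_add_cancel] at hd; grind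
  have s1 := B.sep (i - 1) (by omega) n1 (by rw [sub_add_cancel]; grind)
  have s2 := B.sep (i - 2) (by omega) n2 (by rwa [show i - 2 + 1 = i - 1 by ring])
  have s3 := P.step (i - 1)
  rw [s1, e, s2, n1] at s3
  simp at s3

/-- By `sep` a pair matched strictly behind the front starts with an odd defect, so its removal
closes an odd gap and opens none; the pair at the front is handled by `frontMatch`. -/
lemma Behind.match {q : ℤ} (B : Behind u c q) (P : Par lo hi u c) (I : Inv lo hi r u h) :
    Behind (matchDefects u) (parMatch u c) (frontMatch u c q) := by
  have key : ∀ i ≤ frontMatch u c q, parMatch u c i = true → (matchDefects u i).dfc = false →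
      i ≤ q ∧ c i = true ∧ (u i).dfc = false ∧ (i < frontMatch u c q → i < q) := by
    intro i hi hc hd
    have hcase : i ≤ q ∨ (cor u q = true ∧ c q = true ∧ i = q + 1) := by
      unfold frontMatch at hi
      split_ifs at hi <;> first
        | (left; omega)
        | (by_cases i ≤ q; (left; omega); right; exact ⟨‹_›, ‹_›, by omega⟩)
    rcases hcase with hiq | ⟨h1, h2, rfl⟩
    swap
    · exfalso
      have h3 := P.step (q + 1)
      rw [parMatch] at hc
      simp only [cor, add_sub_cancel_right] at h1 hc h3
      grind
    have hn : cor u i = false := by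
      by_contra hcor
      have hcor : cor u i = true := by simpa using hcor
      have hci : c i = false := by simpa [parMatch, hcor] using hc
      rcases hiq.lt_or_eq with h1 | rfl
      · have := B.sep i (by omega) (by simp only [cor] at hcor; grind)
          (by simp only [cor] at hcor; grind)
        simp [hci] at this
      · simp [frontMatch, hcor, hci] at hi
    have hci : c i = true := by simpa [parMatch, hn] using hc
    refine ⟨hiq, hci, ?_, ?_⟩
    · by_contra hdi
      have hdi : (u i).dfc = true := by simpa using hdi
      have hcor : cor u (i - 1) = true := by
        rw [matchDefects_dfc_eq, hdi, hn] at hd; simpa using hd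
      have h1 := P.step i
      rw [hci, hdi] at h1
      have h2 := B.sep (i - 1) (by omega) (by simp only [cor] at hcor; grind)
        (by rwa [sub_add_cancel])
      simp [h2] at h1
    · intro hlt
      rcases hiq.lt_or_eq with h1 | rfl
      · exact h1
      · simp [frontMatch, hn] at hlt
  refine ⟨fun i hi hc hd => ?_, fun i hi hc hd => ?_, fun i hi hc => ?_, fun i hi hd hd1 => ?_⟩
  · obtain ⟨h1, h2, h3, -⟩ := key i hi hc hd
    rw [matchDefects_fwS]
    exact B.one i h1 h2 h3
  · obtain ⟨h1, h2, h3, h4⟩ := key i hi.le hc hd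
    rw [matchDefects_sta, matchDefects_anS]
    exact B.clean i (h4 hi) h2 h3
  · rw [matchDefects_fwS]
    by_cases hcor : cor u i = true
    · exact I.dfc_fwS i (by simp only [cor] at hcor; grind)
    have hcor : cor u i = false := by simpa using hcor
    have hci : c i = false := by simpa [parMatch, hcor] using hc
    by_cases hiq : i ≤ q
    · exact B.zero i hiq hci
    have h1 : cor u q = true ∧ i = q + 1 := by
      unfold frontMatch at hi; split_ifs at hi <;> first | omega | exact ⟨‹_›, by omega⟩
    obtain ⟨h1, rfl⟩ := h1
    exact I.dfc_fwS _ (by simp only [cor] at h1; grind)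
  · have := B.match_noAdj P i (by omega) hd
    simp [hd1] at this

end
end ASR

/-! ### The front during the rest of an iteration -/

namespace ASR

section
variable {lo hi r : ℤ} {u : Config} {h : ℤ → ℤ} {c : ℤ → Bool} {q : ℤ}

lemma hits_dfc {i : ℤ} (hh : hits u i = true) : (u i).dfc = true := by
  simp only [hits] at hh; grind

lemma Behind.not_hits (B : Behind u c q) {i : ℤ} (hi : i ≤ q) (hc : c i = false) :
    hits u (i + 1) = false := by
  have := B.zero i hi hc
  simp only [hits, add_sub_cancel_right, sendForward_fwS, this]
  grind

lemma Behind.hits_of_dfc (B : Behind u c q) (NA : ∀ i ≤ q, (u i).dfc = true →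
    (u (i + 1)).dfc = false) {i : ℤ} (hi : i ≤ q) (hc : c i = true)
    (hd : (u (i + 1)).dfc = true) : hits u (i + 1) = true := by
  have h1 : (u i).dfc = false := by
    by_contra h0
    have := NA i hi (by simpa using h0)
    simp [hd] at this
  exact hits_of_fwS hd (B.one i hi hc h1)

/-- Behind the front, a site between an odd defect and the next one that is still so after the
iteration and holds no defect then held none before. -/
lemma Behind.beam (B : Behind u c q) (P : Par lo hi u c) {i : ℤ}
    (hi : i ≤ q) (hc : parRest u c i = true) (hd : (rest u i).dfc = false) :
    (u i).dfc = false ∧ c i = true ∧ hits u (i + 1) = false ∧ c (i - 1) = true ∧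
      parRest u c (i - 1) = true := by
  have h1 : hits u (i + 1) = false := by
    rw [rest_dfc, reflected_dfc] at hd; grind
  have h2 : c i = true := by simpa [parRest, h1] using hc
  have h3 : (u i).dfc = false := by
    by_contra hdi
    have hdi : (u i).dfc = true := by simpa using hdi
    have h4 := P.step i
    rw [h2, hdi] at h4
    have h5 := B.not_hits (i := i - 1) (by omega) (by simpa using h4.symm)
    rw [sub_add_cancel] at h5
    rw [rest_dfc, reflected_dfc, h5, hdi] at hd
    simp at hd
  have h4 := P.step i
  rw [h2, h3] at h4
  have h5 : c (i - 1) = true := by simpa using h4.symm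
  refine ⟨h3, h2, h1, h5, ?_⟩
  simp [parRest, h5, hits, h3]

/-- Into a defect nothing crosses; an odd defect at `i - 1` stays in place and withholds its stack;
any other odd site strictly behind the front has no debts. -/
lemma Behind.emitted_anS (B : Behind u c q) (P : Par lo hi u c) (I : Inv lo hi r u h)
    {i : ℤ} (hi : i ≤ q) (hc : parRest u c i = true) :
    (emitted u (i - 1)).anS = false := by
  by_cases hd : (rest u i).dfc = true
  · rw [rest_dfc] at hd
    exact (I.no_crossing_of_two (I.of_reflected_dfc hd).1).2.1
  obtain ⟨h1, h2, h3, h4, -⟩ := B.beam P hi hc (by simpa using hd)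
  have hn : hits u i = false := by simp [hits, h1]
  by_cases hd1 : (u (i - 1)).dfc = true
  · have h5 := P.step (i - 1)
    rw [h4, hd1] at h5
    have h6 := B.not_hits (i := i - 1 - 1) (by omega) (by simpa using h5.symm)
    rw [sub_add_cancel] at h6
    refine emitted_anS_of_dfc ?_ (I.dfc_anS _ hd1)
    rw [reflected_dfc, sub_add_cancel, hn, hd1, h6]; rfl
  · have hd1 : (u (i - 1)).dfc = false := by simpa using hd1
    obtain ⟨h5, h6⟩ := B.clean (i - 1) (by omega) h4 hd1
    have h7 := emitted_debt_le u (i - 1)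
    rw [sendForward_sta_of_not_dfc hd1, h5, h6] at h7
    simp at h7
    exact h7.2

/-- An anti-signal here would have come from one site further left, which by `Behind.beam` is
reached from a site of the same odd gap. -/
lemma Behind.antiOne_anS (B : Behind u c q) (P : Par lo hi u c) (I : Inv lo hi r u h)
    {i : ℤ} (hi : i ≤ q) (hc : parRest u c i = true) :
    (antiOne u (i - 1)).anS = false := by
  by_cases hd : (ASR.rest u i).dfc = true
  · rw [rest_dfc] at hd
    exact (I.no_crossing_of_two (I.of_reflected_dfc hd).1).2.2.1
  by_contra ha
  have h1 := antiOne_anS_imp (u := u) (i := i - 1) (by simpa using ha)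
  rw [B.emitted_anS P I (by omega) (B.beam P hi hc (by simpa using hd)).2.2.2.2] at h1
  simp at h1

lemma Behind.antiTwo_anS (B : Behind u c q) (P : Par lo hi u c) (I : Inv lo hi r u h)
    {i : ℤ} (hi : i ≤ q) (hc : parRest u c i = true) :
    (antiTwo u (i - 1)).anS = false := by
  by_cases hd : (ASR.rest u i).dfc = true
  · rw [rest_dfc] at hd
    exact (I.no_crossing_of_two (I.of_reflected_dfc hd).1).2.2.2.1
  by_contra ha
  have h1 := antiTwo_anS_imp (u := u) (i := i - 1) (by simpa using ha)
  rw [B.antiOne_anS P I (by omega) (B.beam P hi hc (by simpa using hd)).2.2.2.2] at h1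
  simp at h1

lemma Behind.rest_anS (B : Behind u c q) (P : Par lo hi u c) (I : Inv lo hi r u h)
    {i : ℤ} (hi : i ≤ q) (hc : parRest u c i = true) : (rest u i).anS = false := by
  by_contra ha
  have h1 := rest_anS_imp (u := u) (i := i) (by simpa using ha)
  rw [B.antiTwo_anS P I hi hc] at h1
  simp at h1

lemma Behind.sendForward_fwS (B : Behind u c q) {i : ℤ} (hi : i ≤ q) (hc : c i = true)
    (hd : (u (i + 1)).dfc = false) : (sendForward u i).fwS = true := by
  rw [ASR.sendForward_fwS, hd]
  by_cases hdi : (u i).dfc = true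
  · simp [hdi]
  · simp [B.one i hi hc (by simpa using hdi)]

/-- Otherwise the defect at `i` would be even and unmoved, but even defects reached by the filled
gap are always hit. -/
lemma Behind.rest_sep (B : Behind u c q) (P : Par lo hi u c) (I : Inv lo hi r u h)
    (NA : ∀ i ≤ q, (u i).dfc = true → (u (i + 1)).dfc = false) {i : ℤ} (hi : i ≤ q)
    (hd : (rest u i).dfc = true) (hd1 : (rest u (i + 1)).dfc = true) :
    parRest u c i = true := by
  by_contra hc
  rw [rest_dfc, reflected_dfc] at hd hd1
  have h1 : hits u (i + 1) = false := by
    by_contra hh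
    have hh : hits u (i + 1) = true := by simpa using hh
    rw [hh] at hd1
    have := (I.hits_succ (i := i + 1) (by simpa using hd1)).2.1
    rw [hits_dfc hh] at this
    simp at this
  have h2 : c i = false := by simpa [parRest, h1] using hc
  have h3 : (u i).dfc = true ∧ hits u i = false := by grind
  have h4 := P.step i
  rw [h2, h3.1] at h4
  have h5 := B.hits_of_dfc NA (i := i - 1) (by omega) (by simpa using h4.symm)
    (by rw [sub_add_cancel]; exact h3.1)
  rw [sub_add_cancel, h3.2] at h5
  simp at h5

/-- A signal could only come from a defect at `i - 1`, which is even, hence hit; `Inv.self_kill`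
then removes the signal it emitted. -/
lemma Behind.rest_zero (B : Behind u c q) (P : Par lo hi u c) (I : Inv lo hi r u h)
    (NA : ∀ i ≤ q, (u i).dfc = true → (u (i + 1)).dfc = false) {i : ℤ} (hi : i - 1 ≤ q)
    (hc0 : c (i - 1) = false) (hc : parRest u c i = false) : (rest u i).fwS = false := by
  have hR := I.rest
  by_cases hh : hits u (i + 1) = true
  · exact hR.dfc_fwS i (by rw [rest_dfc, reflected_dfc, hh]; rfl)
  have hh : hits u (i + 1) = false := by simpa using hh
  have hci : c i = false := by simpa [parRest, hh] using hc
  have hd : (u i).dfc = false := by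
    have := P.step i
    rw [hci, hc0] at this
    simpa using this.symm
  by_cases hd1 : (u (i - 1)).dfc = true
  · have h1 := P.step (i - 1)
    rw [hc0, hd1] at h1
    have h2 := B.hits_of_dfc NA (i := i - 1 - 1) (by omega) (by simpa using h1.symm)
      (by rw [sub_add_cancel]; exact hd1)
    rw [sub_add_cancel] at h2
    have := I.self_kill h2
    rwa [sub_add_cancel] at this
  · have hd1 : (u (i - 1)).dfc = false := by simpa using hd1
    rw [rest_fwS, reflected_fwS, sendForward_fwS_of_not_dfc hd1, B.zero _ hi hc0]; rfl

/-- Odd gaps are refilled from the left by the shifted forward-signals, and no anti-signal enters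
them. -/
theorem Behind.rest (B : Behind u c q) (P : Par lo hi u c) (I : Inv lo hi r u h)
    (NA : ∀ i ≤ q, (u i).dfc = true → (u (i + 1)).dfc = false) :
    Behind (rest u) (parRest u c) q := by
  have hR := I.rest
  refine ⟨fun i hi hc hd => ?_, fun i hi hc hd => ?_, fun i hi hc => ?_, fun i hi hd hd1 => ?_⟩
  · obtain ⟨h1, h2, h3, h4, -⟩ := B.beam P hi hc hd
    have hn : hits u i = false := by simp [hits, h1]
    have f2 := B.sendForward_fwS (i := i - 1) (by omega) h4 (by rw [sub_add_cancel]; exact h1)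
    rw [rest_fwS, reflected_fwS, f2, hn, h3, B.emitted_anS P I hi hc, B.antiOne_anS P I hi hc]
    simp
  · obtain ⟨h1, h2, -⟩ := B.beam P hi.le hc hd
    refine ⟨?_, B.rest_anS P I hi.le hc⟩
    obtain ⟨h5, h6⟩ := B.clean i hi h2 h1
    have h7 := emitted_debt_le u i
    rw [sendForward_sta_of_not_dfc h1, h5, h6] at h7
    rw [rest_sta]
    simp at h7
    exact h7.1
  · by_cases hc0 : c (i - 1) = true
    swap
    · exact B.rest_zero P I NA (by omega) (by simpa using hc0) hc
    by_cases hh : hits u (i + 1) = true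
    · exact hR.dfc_fwS i (by rw [rest_dfc, reflected_dfc, hh]; rfl)
    have hh : hits u (i + 1) = false := by simpa using hh
    have hci : c i = false := by simpa [parRest, hh] using hc
    have hd : (u i).dfc = true := by
      have := P.step i
      rw [hci, hc0] at this
      simpa using this
    have h2 := B.hits_of_dfc NA (i := i - 1) (by omega) hc0 (by rwa [sub_add_cancel])
    have h3 := (I.of_hits h2).2.2.2
    rw [sub_add_cancel] at h3
    rw [rest_fwS, h3]; rfl
  · exact B.rest_sep P I NA (by omega) hd hd1

/-- In front of an even defect, or of nothing, the front advances. -/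
lemma Behind.rest_of_even (B : Behind u c q) (P : Par lo hi u c) (I : Inv lo hi r u h)
    (NA : ∀ i ≤ q, (u i).dfc = true → (u (i + 1)).dfc = false) (hc : c q = false) :
    Behind (ASR.rest u) (parRest u c) (q + 1) ∧ parRest u c q = false := by
  have h1 : parRest u c q = false := by simp [parRest, hc, B.not_hits le_rfl hc]
  refine ⟨(B.rest P I NA).extend (by simp [h1]) (fun h2 h3 => ?_) (fun h2 => ?_)
    (B.rest_sep P I NA le_rfl), h1⟩
  · have h4 := (P.rest I).step (q + 1)
    rw [add_sub_cancel_right, h1, h2, h3] at h4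
    simp at h4
  · exact B.rest_zero P I NA (by omega) (by simpa using hc) h2

/-- Contact of the front with the next defect at distance one. -/
lemma Behind.rest_of_contact (B : Behind u c q) (P : Par lo hi u c) (I : Inv lo hi r u h)
    (NA : ∀ i ≤ q, (u i).dfc = true → (u (i + 1)).dfc = false) (hc : c q = true)
    (hd : (u (q + 1)).dfc = true) :
    Behind (ASR.rest u) (parRest u c) (q + 1) ∧ parRest u c (q + 1) = false := by
  have hh := B.hits_of_dfc NA le_rfl hc hd
  have h0 : hits u (q + 1 + 1) = false := by
    by_contra h0
    have := (I.hits_succ (i := q + 1) (by simpa using h0)).2.1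
    simp [hd] at this
  have h1 : parRest u c q = false := by simp [parRest, hc, hh]
  have h2 : parRest u c (q + 1) = false := by
    have := P.step (q + 1)
    rw [add_sub_cancel_right, hc, hd] at this
    simp [parRest, this, h0]
  refine ⟨(B.rest P I NA).extend (by simp [h1]) (by simp [h2]) (fun _ => ?_)
    (B.rest_sep P I NA le_rfl), h2⟩
  rw [rest_fwS, (I.of_hits hh).2.2.2]; rfl

/-- Contact of the front with the next defect at distance two, which moves to the front. -/
lemma Behind.rest_of_contact_two (B : Behind u c q) (P : Par lo hi u c) (I : Inv lo hi r u h)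
    (NA : ∀ i ≤ q, (u i).dfc = true → (u (i + 1)).dfc = false) (hc : c q = true)
    (hh : hits u (q + 1 + 1) = true) :
    Behind (ASR.rest u) (parRest u c) (q + 1 + 1) ∧ parRest u c (q + 1 + 1) = false := by
  obtain ⟨hd2, hd1, -⟩ := I.hits_succ hh
  have h0 : hits u (q + 1) = false := by simp [hits, hd1]
  have h3 : hits u (q + 1 + 1 + 1) = false := by
    by_contra h0
    have := (I.hits_succ (i := q + 1 + 1) (by simpa using h0)).2.1
    simp [hd2] at this
  have c1 : c (q + 1) = true := by
    have := P.step (q + 1)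
    rw [add_sub_cancel_right, hc, hd1] at this
    simpa using this
  have c2 : c (q + 1 + 1) = false := by
    have := P.step (q + 1 + 1)
    rw [add_sub_cancel_right, c1, hd2] at this
    simpa using this
  have p0 : parRest u c q = true := by simp [parRest, hc, h0]
  have p1 : parRest u c (q + 1) = false := by simp [parRest, c1, hh]
  have p2 : parRest u c (q + 1 + 1) = false := by simp [parRest, c2, h3]
  have hd4 : (reflected u (q + 1)).dfc = true := by rw [reflected_dfc, hh]; rfl
  have hd5 : (ASR.rest u (q + 1 + 1)).dfc = false := by
    rw [rest_dfc, reflected_dfc, hh, h3]; simp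
  refine ⟨((B.rest P I NA).extend (fun _ hq => ?_) (by simp [p1]) (fun _ => ?_)
    (B.rest_sep P I NA le_rfl)).extend (by simp [p1]) (by simp [p2]) (fun _ => ?_)
    (by simp [hd5]), p2⟩
  · refine ⟨?_, B.rest_anS P I le_rfl p0⟩
    -- No anti-signal crosses into the defect now at `q + 1`, so `q` emits none; being without
    -- defect, it has no debts.
    have ha := (I.no_crossing_of_two (I.of_reflected_dfc hd4).1).2.1
    rw [add_sub_cancel_right] at ha
    rw [rest_dfc] at hq
    by_contra hs
    rw [rest_sta] at hs
    have := emitted_debt u q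
    have := emitted_anS_of_debt hq (by omega)
    simp [ha] at this
  · rw [rest_fwS, (I.of_hits hh).2.2.1]; rfl
  · rw [rest_fwS, (I.of_hits hh).2.2.2]; rfl

/-- Away from the next defect the front advances, if there are no debts at the front. -/
lemma Behind.rest_of_advance (B : Behind u c q) (P : Par lo hi u c) (I : Inv lo hi r u h)
    (NA : ∀ i ≤ q, (u i).dfc = true → (u (i + 1)).dfc = false) (hc : c q = true)
    (hd1 : (u (q + 1)).dfc = false) (h2 : hits u (q + 1 + 1) = false)
    (hD : (ASR.rest u q).dfc = false → (backThree u q).sta + (backThree u q).anS.toNat = 0) :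
    Behind (ASR.rest u) (parRest u c) (q + 1) ∧ (emitted u q).anS = false := by
  have h0 : hits u (q + 1) = false := by simp [hits, hd1]
  have p0 : parRest u c q = true := by simp [parRest, hc, h0]
  have p1 : parRest u c (q + 1) = true := by
    have := P.step (q + 1)
    rw [add_sub_cancel_right, hc, hd1] at this
    simp [parRest, h2, this]
  have ha : (emitted u q).anS = false := by
    by_cases hq : (ASR.rest u q).dfc = true
    · have hq' := hq
      rw [rest_dfc, reflected_dfc, h0] at hq'
      rw [rest_dfc] at hq
      exact emitted_anS_of_dfc hq (I.dfc_anS q (by grind))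
    · have h1 := emitted_debt u q
      have h3 := hD (by simpa using hq)
      exact toNat_eq_zero.1 (by omega)
  have ha1 : (antiOne u q).anS = false := by
    by_contra hb
    have h1 := antiOne_anS_imp (u := u) (i := q) (by simpa using hb)
    rw [B.emitted_anS P I le_rfl p0] at h1
    simp at h1
  refine ⟨(B.rest P I NA).extend (fun _ hq => ?_) (fun _ _ => ?_) (by simp [p1])
    (B.rest_sep P I NA le_rfl), ha⟩
  · refine ⟨?_, B.rest_anS P I le_rfl p0⟩
    have h1 := emitted_debt u q
    have h3 := hD hq
    rw [rest_sta]; omega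
  · rw [rest_fwS, reflected_fwS, add_sub_cancel_right, B.sendForward_fwS le_rfl hc hd1, h0, h2,
      ha, ha1]
    simp

end
end ASR

/-! ### Debts, blocks and the potential of the front -/

namespace ASR

/-- The number of stack increments and anti-signals at a site. -/
def debt (s : Site) : ℕ := s.sta + s.anS.toNat

lemma sum_Ico_add_one {M : Type*} [AddCommMonoid M] (f : ℤ → M) {m n : ℤ} (hmn : m ≤ n) :
    ∑ i ∈ Finset.Ico m (n + 1), f i = ∑ i ∈ Finset.Ico m n, f i + f n := by
  have : Finset.Ico m (n + 1) = insert n (Finset.Ico m n) := by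
    ext i; simp only [Finset.mem_Ico, Finset.mem_insert]; omega
  rw [this, Finset.sum_insert (by simp), add_comm]

lemma sum_Ico_eq_add {M : Type*} [AddCommMonoid M] (f : ℤ → M) {m n : ℤ} (hmn : m < n) :
    ∑ i ∈ Finset.Ico m n, f i = f m + ∑ i ∈ Finset.Ico (m + 1) n, f i := by
  have : Finset.Ico m n = insert m (Finset.Ico (m + 1) n) := by
    ext i; simp only [Finset.mem_Ico, Finset.mem_insert]; omega
  rw [this, Finset.sum_insert (by simp)]

/-- Signals that move to the right without entering at `m` do not increase in number. -/
lemma sum_toNat_le_of_shift {a b : ℤ → Bool} {m : ℤ} (hm : b m = false)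
    (hab : ∀ i, b i = true → a (i - 1) = true) (n : ℤ) :
    ∑ i ∈ Finset.Ico m n, (b i).toNat ≤ ∑ i ∈ Finset.Ico m n, (a i).toNat := by
  rcases le_total n m with h | h
  · simp [h]
  have key : ∑ i ∈ Finset.Ico m (n + 1), (b i).toNat ≤ ∑ i ∈ Finset.Ico m n, (a i).toNat := by
    induction n, h using Int.leInduction with
    | base => rw [sum_Ico_add_one _ le_rfl]; simp [hm]
    | succ n hn ih =>
      rw [sum_Ico_add_one _ (by omega), sum_Ico_add_one (fun i => (a i).toNat) hn]
      have := hab (n + 1)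
      rw [add_sub_cancel_right] at this
      refine add_le_add ih ?_
      cases hb : b (n + 1)
      · simp
      · simp [this hb]
  rw [sum_Ico_add_one _ h] at key
  omega

/-- Telescoped charge; between bonds of zero height it bounds the debts by the signals. -/
lemma sum_debt_eq {h : ℤ → ℤ} {u : Config} (H : IsHeight h u) {m n : ℤ} (hmn : m ≤ n) :
    ((∑ i ∈ Finset.Ico m n, debt (u i) : ℕ) : ℤ) = h (n - 1) - h (m - 1) +
      (∑ i ∈ Finset.Ico m n, ((u i).fwS.toNat + (u i).bwS.toNat) : ℕ) := by
  induction n, hmn using Int.leInduction with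
  | base => simp
  | succ n hn ih =>
    rw [sum_Ico_add_one _ hn, sum_Ico_add_one _ hn]
    push_cast at ih ⊢
    rw [ih]
    have := H n
    simp only [charge, debt] at this ⊢
    rw [add_sub_cancel_right]
    generalize (u n).anS = a, (u n).fwS = f, (u n).bwS = b at this ⊢
    cases a <;> cases f <;> cases b <;> simp at this ⊢ <;> omega

lemma sum_signals_le (u : Config) {m n : ℤ} (hmn : m ≤ n) :
    ((∑ i ∈ Finset.Ico m n, ((u i).fwS.toNat + (u i).bwS.toNat) : ℕ) : ℤ) ≤ 2 * (n - m) := by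
  have : ∑ i ∈ Finset.Ico m n, ((u i).fwS.toNat + (u i).bwS.toNat) ≤
      ∑ i ∈ Finset.Ico m n, 2 := by
    refine Finset.sum_le_sum fun i _ => ?_
    have := Bool.toNat_le (u i).fwS
    have := Bool.toNat_le (u i).bwS
    omega
  rw [Finset.sum_const, Int.card_Ico, smul_eq_mul] at this
  omega

/-- The number of pairs of sites, moving with the forward-signals, that hold a forward-signal in
`[m, n)`. -/
noncomputable def blocks (t : ℤ) (u : Config) (m n : ℤ) : ℕ :=
  (((Finset.Ico m n).filter fun i => (u i).fwS = true).image fun i => (t - i) / 2).card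

lemma blocks_le (t : ℤ) (u : Config) {m n : ℤ} (hmn : m ≤ n) :
    2 * (blocks t u m n : ℤ) ≤ n - m + 2 := by
  have : blocks t u m n ≤ (Finset.Icc ((t - n + 1) / 2) ((t - m) / 2)).card := by
    refine Finset.card_le_card fun b hb => ?_
    simp only [Finset.mem_image, Finset.mem_filter, Finset.mem_Ico] at hb
    obtain ⟨i, hi, rfl⟩ := hb
    rw [Finset.mem_Icc]
    omega
  rw [Int.card_Icc] at this
  omega

lemma blocks_union_le (t : ℤ) (u : Config) {m k n : ℤ} :
    blocks t u m n ≤ blocks t u m k + blocks t u k n := by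
  unfold blocks
  refine (Finset.card_le_card ?_).trans (Finset.card_union_le _ _)
  rw [← Finset.image_union]
  refine Finset.image_subset_image fun i => ?_
  simp only [Finset.mem_union, Finset.mem_filter, Finset.mem_Ico]
  grind

/-- The debts in `[q, y)`, except those of a defect at `q`. -/
noncomputable def load (u : Config) (q y : ℤ) : ℕ :=
  ∑ i ∈ Finset.Ico (q + 1) y, debt (u i) + if (u q).dfc then 0 else debt (u q)

/-- `y` is the first defect after `q`. -/
structure Next (u : Config) (q y : ℤ) : Prop where
  lt : q < y
  dfc : (u y).dfc = true
  not_dfc : ∀ i, q < i → i < y → (u i).dfc = false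

section
variable {lo hi r t : ℤ} {u : Config} {h : ℤ → ℤ} {c : ℤ → Bool} {q : ℤ}

lemma Par.exists_next (P : Par lo hi u c) (hc : c q = true) : ∃ y, Next u q y := by
  have h1 : ∃ n : ℕ, (u (q + 1 + n)).dfc = true := by
    by_contra hn
    push Not at hn
    have : ∀ n : ℕ, c (q + n) = true := by
      intro n
      induction n with
      | zero => simpa using hc
      | succ n ih =>
        have h2 := P.step (q + (n + 1 : ℕ))
        have h3 := hn n
        rw [show q + ((n + 1 : ℕ) : ℤ) - 1 = q + n by push_cast; ring, ih,
          show q + ((n + 1 : ℕ) : ℤ) = q + 1 + n by push_cast; ring] at h2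
        rw [show q + ((n + 1 : ℕ) : ℤ) = q + 1 + n by push_cast; ring, h2]
        simpa using h3
    have h2 := this (hi - q).toNat
    rw [P.right _ (by omega)] at h2
    simp at h2
  classical
  refine ⟨q + 1 + (Nat.find h1 : ℕ), by omega, Nat.find_spec h1, fun i h2 h3 => ?_⟩
  have h4 := Nat.find_min h1 (m := (i - q - 1).toNat) (by omega)
  rw [show q + 1 + ((i - q - 1).toNat : ℤ) = i by omega] at h4
  simpa using h4

/-- The state of the front at time `t`, with a bound `B` on the remaining time. -/
def Front (t hi : ℤ) (u : Config) (c : ℤ → Bool) (q B : ℤ) : Prop :=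
  -- In an odd gap ending at `y`: one iteration per site advanced, one per debt in the load, and 4
  -- per block of forward-signals to pay for `y` moving left by one. A defect at `q` is excluded
  -- from the load since it withholds its stack. The coefficient 5 bounds the potential of a fresh
  -- gap: blocks and debts each contribute at most 2 per site.
  Behind u c q ∧ ((c q = false ∧ 5 * (hi - q) ≤ B) ∨ (c q = true ∧ ∃ y, Next u q y ∧
    (hi - q) + 4 * (hi - y) + 4 * blocks t u (q + 1) y + load u q y ≤ B))

lemma cor_eq_true {i : ℤ} : cor u i = true ↔
    (u (i - 1)).dfc = false ∧ (u i).dfc = true ∧ (u (i + 1)).dfc = true := by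
  simp only [cor]; grind

lemma dfc_of_matchDefects {i : ℤ} (hd : (matchDefects u i).dfc = true) : (u i).dfc = true := by
  rw [matchDefects_dfc_eq] at hd; grind

lemma matchDefects_dfc_of_cor {i : ℤ} (hc : cor u i = true) :
    (matchDefects u i).dfc = false ∧ (matchDefects u (i + 1)).dfc = false := by
  rw [matchDefects_dfc_eq, matchDefects_dfc_eq, add_sub_cancel_right, hc]; simp

lemma debt_matchDefects (i : ℤ) : debt (matchDefects u i) = debt (u i) := by
  rw [debt, matchDefects_sta, matchDefects_anS, debt]

lemma blocks_matchDefects (m n : ℤ) : blocks t (matchDefects u) m n = blocks t u m n := by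
  simp only [blocks, matchDefects_fwS]

/-- The blocks and debts between a matched pair and the next defect. -/
lemma Inv.jump_le (I : Inv lo hi r u h) {y z : ℤ} (hcor : cor u y = true) (hyz : y + 2 ≤ z)
    (hz : (u z).dfc = true) :
    4 * (blocks t u y z : ℤ) + (∑ i ∈ Finset.Ico y z, debt (u i) : ℕ) + 4 ≤ 4 * (z - y) := by
  obtain ⟨-, h1, h2⟩ := cor_eq_true.1 hcor
  have f1 := I.dfc_fwS _ h1
  have f2 := I.dfc_fwS _ h2
  have b1 := I.dfc_bwS_self h1
  have b2 := I.dfc_bwS_self h2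
  -- The matched pair carries no signals; omitting its two sites from the count of signals saves the
  -- 4 of the statement.
  have e1 : blocks t u y z = blocks t u (y + 2) z := by
    unfold blocks
    congr 2
    ext i
    simp only [Finset.mem_filter, Finset.mem_Ico]
    constructor
    · rintro ⟨h3, h4⟩
      have : i ≠ y := by rintro rfl; simp [f1] at h4
      have : i ≠ y + 1 := by rintro rfl; simp [f2] at h4
      exact ⟨by omega, h4⟩
    · rintro ⟨h3, h4⟩
      exact ⟨by omega, h4⟩
  have e2 := sum_debt_eq I.height (m := y) (n := z) (by omega)
  rw [sum_Ico_eq_add (fun i => (u i).fwS.toNat + (u i).bwS.toNat) (by omega),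
    sum_Ico_eq_add (fun i => (u i).fwS.toNat + (u i).bwS.toNat) (by omega), I.dfc_height _ hz,
    I.dfc_height _ h1, f1, f2, b1, b2] at e2
  have e3 := sum_signals_le u (m := y + 1 + 1) (n := z) (by omega)
  have e4 := blocks_le t u (m := y + 2) (n := z) (by omega)
  simp only [Bool.toNat_false, add_zero, zero_add, sub_zero] at e2
  omega

/-- When the matching removes `y` and the gap extends to `z`, the drop `4 * (z - y)` pays for the
new blocks and debts (`Inv.jump_le`). -/
theorem Front.match {B : ℤ} (F : Front t hi u c q B) (P : Par lo hi u c) (I : Inv lo hi r u h) :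
    Front t hi (matchDefects u) (parMatch u c) (frontMatch u c q) B := by
  obtain ⟨Bh, F⟩ := F
  refine ⟨Bh.match P I, ?_⟩
  have P' := P.match I
  by_cases hcor : cor u q = true
  · obtain ⟨d0, d1, d2⟩ := cor_eq_true.1 hcor
    rcases F with ⟨hc, hB⟩ | ⟨hc, y, N, hB⟩
    · right
      have hq : frontMatch u c q = q - 1 := by simp [frontMatch, hcor, hc]
      rw [hq]
      have h1 : cor u (q - 1) = false := by simp [cor, d0]
      have h2 : c (q - 1) = true := by
        have := P.step q
        rw [hc, d1] at this; simpa using this.symm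
      have h3 : parMatch u c (q - 1) = true := by simp [parMatch, h1, h2]
      refine ⟨h3, ?_⟩
      obtain ⟨z, N⟩ := P'.exists_next h3
      refine ⟨z, N, ?_⟩
      have hz : q + 2 ≤ z := by
        have := N.lt
        have := N.dfc
        have := matchDefects_dfc_of_cor hcor
        have : z ≠ q := by rintro rfl; simp_all
        have : z ≠ q + 1 := by rintro rfl; simp_all
        omega
      have hJ := I.jump_le (t := t) hcor hz (dfc_of_matchDefects N.dfc)
      have hd := I.height (q - 1)
      rw [I.dfc_height q d1] at hd
      have hn := I.nonneg (q - 1 - 1)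
      have hb := I.dfc_bwS q d1
      have hf := toInt_le_one (u (q - 1)).fwS
      -- The height at `q - 1` is zero, so its debts are at most its forward-signals. With the
      -- retreat by one site this costs 2 of the spare 4.
      have hD : (debt (u (q - 1)) : ℤ) ≤ 1 := by
        rw [debt]
        simp only [charge, hb] at hd
        cases ha : (u (q - 1)).anS <;> simp [ha] at hd ⊢ <;> omega
      have hD' : (if (matchDefects u (q - 1)).dfc then 0 else debt (u (q - 1))) ≤
        debt (u (q - 1)) := by split_ifs <;> simp
      rw [load, blocks_matchDefects, sub_add_cancel]
      simp only [debt_matchDefects]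
      push_cast at hJ hD' ⊢
      omega
    · left
      have hq : frontMatch u c q = q + 1 := by simp [frontMatch, hcor, hc]
      rw [hq]
      have h1 : cor u (q + 1) = false := by simp [cor, d1]
      have h2 : c (q + 1) = false := by
        have := P.step (q + 1)
        rw [add_sub_cancel_right, hc, d2] at this; simpa using this
      refine ⟨by simp [parMatch, h1, h2], ?_⟩
      have hy : y = q + 1 := by
        by_contra hne
        have := N.not_dfc (q + 1) (by omega) (by have := N.lt; omega)
        simp [d2] at this
      omega
  have hcor : cor u q = false := by simpa using hcor
  have hq : frontMatch u c q = q := by simp [frontMatch, hcor]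
  have hcq : parMatch u c q = c q := by simp [parMatch, hcor]
  rw [hq, hcq]
  refine F.imp id fun ⟨hc, y, N, hB⟩ => ⟨hc, ?_⟩
  have hdq : (matchDefects u q).dfc = (u q).dfc := by
    rw [matchDefects_dfc_eq, hcor]
    by_cases hd : (u q).dfc = true
    swap
    · simp [hd]
    have : cor u (q - 1) = false := by
      by_contra hx
      obtain ⟨-, h1, h2⟩ := cor_eq_true.1 (by simpa using hx : cor u (q - 1) = true)
      have h3 := Bh.sep (q - 1) (by omega) h1 h2
      have h4 := P.step q
      rw [h3, hd, hc] at h4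
      simp at h4
    simp [this]
  have hnot : ∀ i, q < i → i < y → (matchDefects u i).dfc = false := by
    intro i h1 h2
    by_contra hx
    have := dfc_of_matchDefects (by simpa using hx)
    simp [N.not_dfc i h1 h2] at this
  have hL : ∀ z, load (matchDefects u) q z = load u q z := by
    intro z
    simp only [load, debt_matchDefects, hdq]
  by_cases hy : (matchDefects u y).dfc = true
  · refine ⟨y, ⟨N.lt, hy, hnot⟩, ?_⟩
    rw [hL, blocks_matchDefects]
    exact hB
  have hcy : cor u y = true := by
    rw [matchDefects_dfc_eq, N.dfc] at hy
    by_contra hx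
    have hx : cor u y = false := by simpa using hx
    have h1 : cor u (y - 1) = true := by simpa [hx] using hy
    have h2 := (cor_eq_true.1 h1).2.1
    have h3 := N.lt
    by_cases h4 : y - 1 = q
    · rw [h4, hcor] at h1; simp at h1
    · simp [N.not_dfc (y - 1) (by omega) (by omega)] at h2
  obtain ⟨z, N'⟩ := P'.exists_next (hcq.trans hc)
  refine ⟨z, N', ?_⟩
  have hlt := N.lt
  have hz : y + 2 ≤ z := by
    have h1 := N'.dfc
    have h2 := matchDefects_dfc_of_cor hcy
    have : ¬ z < y := fun hzy => by simp [hnot z N'.lt hzy] at h1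
    have : z ≠ y := by rintro rfl; simp_all
    have : z ≠ y + 1 := by rintro rfl; simp_all
    omega
  have hJ := I.jump_le (t := t) hcy hz (dfc_of_matchDefects N'.dfc)
  have hU := blocks_union_le t u (m := q + 1) (k := y) (n := z)
  have hS := Finset.sum_union (s₁ := Finset.Ico (q + 1) y) (s₂ := Finset.Ico y z)
    (f := fun i => debt (u i)) (Finset.Ico_disjoint_Ico_consecutive _ _ _)
  rw [Finset.Ico_union_Ico_eq_Ico (by omega) (by omega)] at hS
  rw [hL, blocks_matchDefects]
  unfold load at hB ⊢
  rw [hS]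
  push_cast at hB hJ hU ⊢
  omega

end
end ASR

/-! ### Decrease of the potential -/

namespace ASR
section
variable {lo hi r t : ℤ} {u : Config} {h : ℤ → ℤ} {c : ℤ → Bool} {q : ℤ}

/-- The debts in `(q, y)` do not increase if no anti-signal enters this interval. -/
lemma sum_debt_rest_le {y z : ℤ} (hzy : z ≤ y) (hd : ∀ i, q < i → i < y → (u i).dfc = false)
    (h1 : (antiOne u (q + 1)).anS = false) (h2 : (antiOne u q).anS = false)
    (h3 : (antiTwo u q).anS = false) :
    ∑ i ∈ Finset.Ico (q + 1) z, debt (rest u i) ≤ ∑ i ∈ Finset.Ico (q + 1) y, debt (u i) := by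
  have e1 := sum_toNat_le_of_shift (a := fun i => (emitted u i).anS)
    (b := fun i => (antiOne u i).anS) h1 (fun _ => antiOne_anS_imp) z
  have e2 := sum_toNat_le_of_shift (a := fun i => (antiOne u i).anS)
    (b := fun i => (antiTwo u i).anS) (m := q + 1) (by
      by_contra hx
      have := antiTwo_anS_imp (u := u) (i := q + 1) (by simpa using hx)
      simp [h2] at this) (fun _ => antiTwo_anS_imp) z
  have e3 := sum_toNat_le_of_shift (a := fun i => (antiTwo u i).anS)
    (b := fun i => (rest u i).anS) (m := q + 1) (by
      by_contra hx
      have := rest_anS_imp (u := u) (i := q + 1) (by simpa using hx)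
      simp [h3] at this) (fun _ => rest_anS_imp) z
  calc ∑ i ∈ Finset.Ico (q + 1) z, debt (rest u i)
      ≤ ∑ i ∈ Finset.Ico (q + 1) z, debt (emitted u i) := by
        simp only [debt, Finset.sum_add_distrib, rest_sta]
        omega
    _ ≤ ∑ i ∈ Finset.Ico (q + 1) z, debt (u i) := by
        refine Finset.sum_le_sum fun i hi => ?_
        rw [Finset.mem_Ico] at hi
        have := emitted_debt_le u i
        rwa [sendForward_sta_of_not_dfc (hd i (by omega) (by omega))] at this
    _ ≤ ∑ i ∈ Finset.Ico (q + 1) y, debt (u i) :=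
        Finset.sum_le_sum_of_subset (Finset.Ico_subset_Ico le_rfl hzy)

lemma rest_fwS_imp {i : ℤ} (hd : (u (i - 1)).dfc = false) (hf : (rest u i).fwS = true) :
    (u (i - 1)).fwS = true := by
  rw [rest_fwS, reflected_fwS, sendForward_fwS_of_not_dfc hd] at hf
  grind

lemma blocks_rest_le {m y z : ℤ} (hzy : z ≤ y)
    (hd : ∀ i, q < i → i < y → (u i).dfc = false)
    (hf : ∀ i, m ≤ i → (rest u i).fwS = true → q + 2 ≤ i) :
    blocks (t + 1) (rest u) m z ≤ blocks t u (q + 1) y := by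
  refine Finset.card_le_card fun b hb => ?_
  simp only [Finset.mem_image, Finset.mem_filter, Finset.mem_Ico] at hb ⊢
  obtain ⟨i, ⟨h1, h2⟩, rfl⟩ := hb
  have := hf i h1.1 h2
  exact ⟨i - 1, ⟨by omega, rest_fwS_imp (hd _ (by omega) (by omega)) h2⟩, by ring_nf⟩

/-- While the signals move right, the end `y` moves left, so two comoving sites leave the gap. They
need not form one pair, but the pair of the hitting signal at `y - 1` is lost entirely; with single
sites as blocks each hit would also cost only one. -/
lemma blocks_rest_lt {m y : ℤ} (hqy : q + 2 ≤ y)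
    (hd : ∀ i, q < i → i < y → (u i).dfc = false)
    (hf : ∀ i, m ≤ i → (rest u i).fwS = true → q + 2 ≤ i) (hy : (u (y - 1)).fwS = true) :
    blocks (t + 1) (rest u) m (y - 1) + 1 ≤ blocks t u (q + 1) y := by
  refine Finset.card_lt_card ?_
  rw [Finset.ssubset_iff]
  refine ⟨(t - (y - 1)) / 2, ?_, fun b hb => ?_⟩
  · simp only [Finset.mem_image, Finset.mem_filter, Finset.mem_Ico]
    rintro ⟨i, hi, h1⟩
    omega
  simp only [Finset.mem_insert, Finset.mem_image, Finset.mem_filter, Finset.mem_Ico] at hb ⊢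
  rcases hb with rfl | ⟨i, ⟨h1, h2⟩, rfl⟩
  · exact ⟨y - 1, ⟨by omega, hy⟩, rfl⟩
  have := hf i h1.1 h2
  exact ⟨i - 1, ⟨by omega, rest_fwS_imp (hd _ (by omega) (by omega)) h2⟩, by ring_nf⟩

/-- The next defect after the iteration, while the front is away from it. -/
lemma Next.rest_of_away {y : ℤ} (N : Next u q y) (I : Inv lo hi r u h)
    (hd1 : (u (q + 1)).dfc = false) (hh2 : hits u (q + 1 + 1) = false) {p m : ℤ} (hqp : q ≤ p) (hpq : p ≤ q + 1)
    (hf : ∀ i, m ≤ i → (rest u i).fwS = true → q + 2 ≤ i) :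
    ∃ z, Next (rest u) p z ∧ z ≤ y ∧
      4 * (hi - z) + 4 * (blocks (t + 1) (rest u) m z : ℤ) ≤
        4 * (hi - y) + 4 * blocks t u (q + 1) y := by
  have hlt := N.lt
  have hy : q + 2 ≤ y := by
    by_contra hx
    have := N.dfc
    rw [show y = q + 1 by omega, hd1] at this
    simp at this
  have key : ∀ i, q < i → i < y → hits u (i + 1) = false → (rest u i).dfc = false := by
    intro i h1 h2 h3
    rw [rest_dfc, reflected_dfc, h3, N.not_dfc i h1 h2]; rfl
  have key2 : ∀ i, q < i → i + 1 < y → (rest u i).dfc = false := by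
    intro i h1 h2
    refine key i h1 (by omega) ?_
    simp [hits, N.not_dfc (i + 1) (by omega) h2]
  by_cases hh : hits u y = true
  · have hh' : hits u (y - 1 + 1) = true := by rwa [sub_add_cancel]
    have hy3 : q + 3 ≤ y := by
      by_contra hx
      rw [show y = q + 1 + 1 by omega, hh2] at hh
      simp at hh
    refine ⟨y - 1, ⟨by omega, ?_, fun i h1 h2 => key2 i (by omega) (by omega)⟩, by omega, ?_⟩
    · rw [rest_dfc, reflected_dfc, hh']; rfl
    -- Moving `y` to `y - 1` costs 4, and the lost block repays it.
    · have := blocks_rest_lt (t := t) hy N.not_dfc hf (I.hits_succ hh').2.2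
      omega
  · have hh : hits u y = false := by simpa using hh
    refine ⟨y, ⟨by omega, ?_, fun i h1 h2 => ?_⟩, le_rfl, ?_⟩
    · rw [rest_dfc, reflected_dfc, hh, N.dfc]; simp
    · by_cases hi : i + 1 = y
      · exact key i (by omega) h2 (by rwa [hi])
      · exact key2 i (by omega) (by omega)
    · have := blocks_rest_le (t := t) le_rfl N.not_dfc hf
      omega

/-- Each iteration the front advances, or it waits while a debt at `q` kills the next
forward-signal; the potential falls by at least one either way. -/
theorem Front.rest {B : ℤ} (F : Front t hi u c q B) (P : Par lo hi u c) (I : Inv lo hi r u h)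
    (NA : ∀ i ≤ q, (u i).dfc = true → (u (i + 1)).dfc = false) :
    ∃ p, Front (t + 1) hi (rest u) (parRest u c) p (B - 1) := by
  obtain ⟨Bh, ⟨hc, hB⟩ | ⟨hc, y, N, hB⟩⟩ := F
  · obtain ⟨Bh', hc'⟩ := Bh.rest_of_even P I NA hc
    refine ⟨q + 1, Bh', ?_⟩
    cases hc1 : parRest u c (q + 1)
    · exact Or.inl ⟨rfl, by omega⟩
    right
    refine ⟨rfl, ?_⟩
    obtain ⟨y, N⟩ := (P.rest I).exists_next hc1
    refine ⟨y, N, ?_⟩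
    have hd : (ASR.rest u (q + 1)).dfc = true := by
      have := (P.rest I).step (q + 1)
      rw [hc1, add_sub_cancel_right, hc'] at this
      simpa using this.symm
    have hlt := N.lt
    -- A new odd gap opens at `q + 1`: four times the blocks is at most `2 * (y - q)` and the debts
    -- are at most `2 * (y - q - 2)`, which gives at most `5 * (hi - (q + 1))` in all.
    have e1 := blocks_le (t + 1) (ASR.rest u) (m := q + 1 + 1) (n := y) (by omega)
    have e2 := sum_debt_eq I.rest.height (m := q + 1 + 1) (n := y) (by omega)
    have e3 := sum_signals_le (ASR.rest u) (m := q + 1 + 1) (n := y) (by omega)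
    have e4 := I.rest.nonneg (q + 1 + 1 - 1)
    rw [I.rest.dfc_height y N.dfc] at e2
    rw [load, hd]
    simp only [if_true, add_zero]
    omega
  have hlt := N.lt
  by_cases hd1 : (u (q + 1)).dfc = true
  · obtain ⟨Bh', hc'⟩ := Bh.rest_of_contact P I NA hc hd1
    refine ⟨q + 1, Bh', Or.inl ⟨hc', ?_⟩⟩
    have : y = q + 1 := by
      by_contra hne
      have := N.not_dfc (q + 1) (by omega) (by omega)
      simp [hd1] at this
    omega
  have hd1 : (u (q + 1)).dfc = false := by simpa using hd1
  have hy1 : y ≠ q + 1 := by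
    rintro rfl
    have := N.dfc
    simp [hd1] at this
  by_cases hh2 : hits u (q + 1 + 1) = true
  · obtain ⟨Bh', hc'⟩ := Bh.rest_of_contact_two P I NA hc hh2
    refine ⟨q + 1 + 1, Bh', Or.inl ⟨hc', ?_⟩⟩
    have : y = q + 1 + 1 := by
      by_contra hne
      have := N.not_dfc (q + 1 + 1) (by omega) (by omega)
      simp [hits_dfc hh2] at this
    omega
  have hh2 : hits u (q + 1 + 1) = false := by simpa using hh2
  have hh1 : hits u (q + 1) = false := by simp [hits, hd1]
  have p0 : parRest u c q = true := by simp [parRest, hc, hh1]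
  have p1 : parRest u c (q + 1) = true := by
    have := P.step (q + 1)
    rw [add_sub_cancel_right, hc, hd1] at this
    simp [parRest, hh2, this]
  have a1 : (antiOne u q).anS = false := by
    by_contra hx
    have := antiOne_anS_imp (u := u) (i := q) (by simpa using hx)
    simp [Bh.emitted_anS P I le_rfl p0] at this
  have a2 : (antiTwo u q).anS = false := by
    by_contra hx
    have := antiTwo_anS_imp (u := u) (i := q) (by simpa using hx)
    simp [Bh.antiOne_anS P I le_rfl p0] at this
  by_cases hD : (ASR.rest u q).dfc = false → (backThree u q).sta + (backThree u q).anS.toNat = 0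
  · obtain ⟨Bh', ha⟩ := Bh.rest_of_advance P I NA hc hd1 hh2 hD
    have a3 : (antiOne u (q + 1)).anS = false := by
      by_contra hx
      have := antiOne_anS_imp (u := u) (i := q + 1) (by simpa using hx)
      simp [ha] at this
    obtain ⟨z, N', hzy, hz⟩ := N.rest_of_away (t := t) (p := q + 1) (m := q + 1 + 1) I hd1 hh2
      (by omega) le_rfl (fun i hi _ => by omega)
    refine ⟨q + 1, Bh', Or.inr ⟨p1, z, N', ?_⟩⟩
    have hS := sum_debt_rest_le hzy N.not_dfc a3 a1 a2
    rw [sum_Ico_eq_add _ N'.lt] at hS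
    have hL : load (ASR.rest u) (q + 1) z ≤ load u q y := by
      unfold load
      refine le_add_right (le_trans ?_ hS)
      rw [add_comm]
      refine Nat.add_le_add_right ?_ _
      split_ifs <;> simp
    omega
  · push Not at hD
    obtain ⟨hdq, hD⟩ := hD
    have hdq0 := (Bh.beam P le_rfl p0 hdq).1
    -- The front waits: the anti-signal emitted at `q` annihilates with the forward-signal at `q +
    -- 1`, and the load loses one.
    have ha : (emitted u q).anS = true :=
      emitted_anS_of_debt (by rwa [rest_dfc] at hdq) (by omega)
    have hf : (reflected u (q + 1)).fwS = true := by
      rw [reflected_fwS, add_sub_cancel_right, Bh.sendForward_fwS le_rfl hc hd1, hh1, hh2]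
      simp
    have a3 : (antiOne u (q + 1)).anS = false := by
      rw [antiOne, antiStep_anS, emitted_fwS, hf]; simp
    have hf' : (ASR.rest u (q + 1)).fwS = false := by
      rw [rest_fwS, add_sub_cancel_right, ha]; simp
    obtain ⟨z, N', hzy, hz⟩ := N.rest_of_away (t := t) (p := q) (m := q + 1) I hd1 hh2 le_rfl
      (by omega) (fun i hi h1 => by
        have : i ≠ q + 1 := by rintro rfl; simp [hf'] at h1
        omega)
    refine ⟨q, Bh.rest P I NA, Or.inr ⟨p0, z, N', ?_⟩⟩
    have hS := sum_debt_rest_le hzy N.not_dfc a3 a1 a2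
    have hE := emitted_debt_le u q
    rw [sendForward_sta_of_not_dfc hdq0, ha] at hE
    have hL : load (ASR.rest u) q z + 1 ≤ load u q y := by
      have e : debt (ASR.rest u q) + 1 ≤ debt (u q) := by
        rw [debt, rest_sta, Bh.rest_anS P I le_rfl p0]
        simpa [debt] using hE
      simp only [load, hdq, hdq0, Bool.false_eq_true, if_false]
      omega
    omega

end
end ASR

/-! ### Disappearance of the defects -/

namespace ASR
section
variable {lo hi r t : ℤ} {u : Config} {h : ℤ → ℤ} {c : ℤ → Bool} {q : ℤ}

lemma Inv.iteration (I : Inv lo hi r u h) :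
    Inv lo hi (r + 1) (iteration 3 3 u) (htRest h (ASR.matchDefects u)) := by
  rw [iteration_eq]
  exact I.matchDefects.rest

/-- The parity after an iteration. -/
def parNext (u : Config) (c : ℤ → Bool) : ℤ → Bool := parRest (matchDefects u) (parMatch u c)

lemma Par.iteration (P : Par lo hi u c) (I : Inv lo hi r u h) :
    Par lo hi (iteration 3 3 u) (parNext u c) := by
  rw [iteration_eq]
  exact (P.match I).rest I.matchDefects

lemma Front.iteration {B : ℤ} (F : Front t hi u c q B) (P : Par lo hi u c)
    (I : Inv lo hi r u h) :
    ∃ p, Front (t + 1) hi (iteration 3 3 u) (parNext u c) p (B - 1) := by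
  rw [iteration_eq]
  exact (F.match P I).rest (P.match I) I.matchDefects (F.1.match_noAdj P)

/-- Once its time has elapsed, the front has passed all the defects. -/
lemma Front.le_of_nonpos {B : ℤ} (F : Front t hi u c q B) (I : Inv lo hi r u h) (hB : B ≤ 0) :
    hi ≤ q := by
  obtain ⟨-, ⟨-, h1⟩ | ⟨-, y, N, h1⟩⟩ := F
  · omega
  · have := N.lt
    have := I.dfc_le y N.dfc
    omega

/-- The number of sites between a defect of odd rank and the next one. -/
noncomputable def oddCount (lo hi : ℤ) (c : ℤ → Bool) : ℕ :=
  ((Finset.Ico lo hi).filter fun i => c i = true).card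

lemma Behind.cor_imp (B : Behind u c q) (I : Inv lo hi r u h) (hq : hi ≤ q) {i : ℤ}
    (hc : cor u i = true) : c i = true := by
  obtain ⟨-, h1, h2⟩ := cor_eq_true.1 hc
  exact B.sep i (by have := I.dfc_le _ h2; omega) h1 h2

lemma Behind.parMatch_imp (B : Behind u c q) (I : Inv lo hi r u h) (hq : hi ≤ q) {i : ℤ}
    (hc : parMatch u c i = true) : c i = true := by
  by_cases hx : cor u i = true
  · exact B.cor_imp I hq hx
  · simpa [parMatch, hx] using hc

/-- Odd sites could arise only from a hit on an odd defect, and no forward-signal precedes one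
behind the front. -/
lemma Behind.parNext_imp (B : Behind u c q) (P : Par lo hi u c) (I : Inv lo hi r u h)
    (hq : hi ≤ q) {i : ℤ} (hc : parNext u c i = true) : parMatch u c i = true := by
  have B' := B.match P I
  have hfm : frontMatch u c q = q := by
    rw [frontMatch, if_neg]
    intro hx
    have := I.dfc_le _ (cor_eq_true.1 hx).2.2
    omega
  rw [hfm] at B'
  by_contra hx
  have hx : parMatch u c i = false := by simpa using hx
  have hh : hits (matchDefects u) (i + 1) = true := by
    simpa [parNext, parRest, hx] using hc
  have := I.matchDefects.dfc_le _ (hits_dfc hh)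
  rw [B'.not_hits (by omega) hx] at hh
  simp at hh

/-- Behind the front the odd sites decrease. -/
lemma Behind.oddCount_lt (B : Behind u c q) (P : Par lo hi u c) (I : Inv lo hi r u h)
    (hq : hi ≤ q) {i : ℤ} (hc : c i = true) :
    oddCount lo hi (parNext u c) < oddCount lo hi c := by
  obtain ⟨y, N⟩ := P.exists_next hc
  have hcy : c y = false ∧ c (y - 1) = true := by
    have key : ∀ j, i ≤ j → j < y → c j = true := by
      intro j hij
      induction j, hij using Int.leInduction with
      | base => exact fun _ => hc
      | succ j hj ih =>
        intro hy
        have := P.step (j + 1)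
        rw [add_sub_cancel_right, ih (by omega), N.not_dfc _ (by omega) hy] at this
        simpa using this
    have h1 := key (y - 1) (by have := N.lt; omega) (by omega)
    have := P.step y
    rw [h1, N.dfc] at this
    exact ⟨by simpa using this, h1⟩
  obtain ⟨c0, c1⟩ := hcy
  have hy := I.dfc_le y N.dfc
  have hlo : lo ≤ y - 1 := by
    by_contra hx
    rw [P.left _ (by omega)] at c1
    simp at c1
  -- The last site of the gap is lost: either `y - 1` is the opening defect and is matched with `y`,
  -- or it holds a forward-signal and `y` moves onto it.
  have hdrop : parNext u c (y - 1) = false := by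
    by_contra hx
    have hx : parNext u c (y - 1) = true := by simpa using hx
    have hm := B.parNext_imp P I hq hx
    have hn : cor u (y - 1) = false := by simpa [parMatch, c1] using hm
    have hd : (u (y - 1)).dfc = false := by
      by_contra hd
      have hd : (u (y - 1)).dfc = true := by simpa using hd
      have h1 : (u (y - 1 - 1)).dfc = false := by
        by_contra h2
        have h3 := B.sep (y - 1 - 1) (by omega) (by simpa using h2) (by rwa [sub_add_cancel])
        have h4 := P.step (y - 1)
        rw [h3, hd, c1] at h4
        simp at h4
      have := cor_eq_true.2 ⟨h1, hd, by rw [sub_add_cancel]; exact N.dfc⟩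
      simp [hn] at this
    have hcy : cor u y = false := by
      by_contra h1
      have := B.cor_imp (i := y) I hq (by simpa using h1)
      simp [c0] at this
    have hh : hits (matchDefects u) (y - 1 + 1) = true := by
      refine hits_of_fwS ?_ ?_
      · rw [sub_add_cancel, matchDefects_dfc_eq, N.dfc, hn, hcy]; rfl
      · rw [matchDefects_fwS]; exact B.one _ (by omega) c1 hd
    rw [parNext, parRest, hm, hh] at hx
    simp at hx
  refine Finset.card_lt_card ?_
  rw [Finset.ssubset_iff]
  refine ⟨y - 1, by simp [hdrop], fun j hj => ?_⟩
  simp only [Finset.mem_insert, Finset.mem_filter, Finset.mem_Ico] at hj ⊢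
  rcases hj with rfl | ⟨h1, h2⟩
  · exact ⟨by omega, c1⟩
  · exact ⟨h1, B.parMatch_imp I hq (B.parNext_imp P I hq h2)⟩

lemma Par.eq_false_of_oddCount (P : Par lo hi u c) (h0 : oddCount lo hi c = 0) (i : ℤ) :
    c i = false := by
  by_contra hc
  have hc : c i = true := by simpa using hc
  have h1 : lo ≤ i := by by_contra hx; simp [P.left i (by omega)] at hc
  have h2 : i < hi := by by_contra hx; simp [P.right i (by omega)] at hc
  rw [oddCount, Finset.card_eq_zero] at h0
  have : i ∈ (Finset.Ico lo hi).filter fun i => c i = true := by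
    simp [h1, h2, hc]
  simp [h0] at this

lemma oddCount_le (hle : lo ≤ hi) (c : ℤ → Bool) : (oddCount lo hi c : ℤ) ≤ hi - lo := by
  have := Finset.card_filter_le (Finset.Ico lo hi) fun i => c i = true
  rw [Int.card_Ico] at this
  unfold oddCount
  omega

lemma oddCount_eq_zero (hc : ∀ i, c i = false) : oddCount lo hi c = 0 := by
  simp [oddCount, hc]

/-- The evolution of the front from an initial state. -/
lemma Front.iterate {B : ℤ} (F : Front 0 hi u c q B) (P : Par lo hi u c) (I : Inv lo hi hi u h)
    (hle : lo ≤ hi) (hB : 0 ≤ B) (n : ℕ) :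
    ∃ h' c' p, Inv lo hi (hi + n) ((ASR.iteration 3 3)^[n] u) h' ∧
      Par lo hi ((ASR.iteration 3 3)^[n] u) c' ∧
      Front n hi ((ASR.iteration 3 3)^[n] u) c' p (B - n) ∧
      (B ≤ n → (oddCount lo hi c' : ℤ) ≤ max 0 (hi - lo + B - n)) := by
  induction n with
  | zero =>
    refine ⟨h, c, q, by simpa using I, P, by simpa using F, fun h2 => ?_⟩
    have := oddCount_le hle c
    push_cast at h2 ⊢
    omega
  | succ n ih =>
    obtain ⟨h', c', p, I', P', F', h1⟩ := ih
    obtain ⟨p', F''⟩ := F'.iteration P' I'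
    rw [Function.iterate_succ_apply']
    refine ⟨htRest h' (matchDefects ((ASR.iteration 3 3)^[n] u)), parNext _ c', p', ?_,
      P'.iteration I', ?_, fun h3 => ?_⟩
    · have := I'.iteration
      push_cast
      rwa [← add_assoc]
    · push_cast
      rwa [show B - (n + 1 : ℤ) = B - n - 1 by ring]
    · push_cast at h3 ⊢
      have h4 := oddCount_le hle (parNext ((ASR.iteration 3 3)^[n] u) c')
      by_cases hB : B ≤ n
      swap
      · omega
      have h5 := h1 hB
      have hp := F'.le_of_nonpos I' (by omega)
      by_cases hz : ∃ i, c' i = true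
      · obtain ⟨i, hi⟩ := hz
        have := F'.1.oddCount_lt P' I' hp hi
        omega
      · rw [oddCount_eq_zero]
        · simp
        intro i
        by_contra hx
        exact hz ⟨i, F'.1.parMatch_imp I' hp (F'.1.parNext_imp P' I' hp (by simpa using hx))⟩

/-- After `B + hi - lo` iterations there are no defects. -/
lemma Front.iterate_dfc {B : ℤ} (F : Front 0 hi u c q B) (P : Par lo hi u c)
    (I : Inv lo hi hi u h) (hle : lo ≤ hi) (hB : 0 ≤ B) {n : ℕ} (hn : B + (hi - lo) ≤ n) (i : ℤ) :
    ((ASR.iteration 3 3)^[n] u i).dfc = false := by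
  obtain ⟨h', c', p, I', P', F', h1⟩ := F.iterate P I hle hB n
  have hc := P'.eq_false_of_oddCount (by have := h1 (by omega); omega)
  have := P'.step i
  simpa [hc] using this.symm

end
end ASR

/-! ### Erasure of stacks and signals without defects -/

namespace ASR
section
variable {lo hi r : ℤ} {u : Config} {h : ℤ → ℤ}

lemma iteration_eq_rest (hd : ∀ i, (u i).dfc = false) : iteration 3 3 u = rest u := by
  have : matchDefects u = u := by
    funext i; ext1 <;> simp [matchDefects_dfc, matchDefects_fwS, matchDefects_bwS,
      matchDefects_anS, matchDefects_sta, hd]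
  rw [iteration_eq, this]

lemma backwardStep_sta_le (u : Config) (i : ℤ) : (backwardStep u i).sta ≤ (u i).sta := by
  rw [backwardStep_sta]; split_ifs <;> omega

lemma backThree_sta_le {i : ℤ} (hd : (u i).dfc = false) : (backThree u i).sta ≤ (u i).sta := by
  rw [← sendForward_sta_of_not_dfc hd, ← reflected_sta]
  exact (backwardStep_sta_le _ _).trans
    ((backwardStep_sta_le _ _).trans (backwardStep_sta_le _ _))

lemma rest_sta_le {i : ℤ} (hd : (u i).dfc = false) : (rest u i).sta ≤ (u i).sta := by
  refine le_trans ?_ (backThree_sta_le hd)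
  rw [rest_sta, emitted, sendAnti_sta]; split_ifs <;> omega

lemma reflected_dfc_of_not_dfc (hd : ∀ i, (u i).dfc = false) (i : ℤ) :
    (reflected u i).dfc = false := by
  simp [reflected_dfc, hits, hd]

lemma rest_sta_lt (hd : ∀ i, (u i).dfc = false) {i : ℤ} (hs : 0 < (u i).sta)
    (ha : (u i).anS = false) : (rest u i).sta < (u i).sta := by
  have h1 := backThree_sta_le (hd i)
  have h2 : (backThree u i).anS = false := by
    simp [backThree, backTwo, backOne, backwardStep_anS, reflected_anS, ha]
  rw [rest_sta, emitted, sendAnti_sta, backThree_dfc, reflected_dfc_of_not_dfc hd, h2]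
  simp only [Bool.not_false, Bool.and_self, if_true]
  omega

/-- Anti-signals make exactly three moves per iteration, so one found at `i` left `i - 3`. -/
lemma rest_anS_of_debt (hd : ∀ i, (u i).dfc = false) {i : ℤ} (h0 : debt (u (i - 3)) = 0) :
    (rest u i).anS = false := by
  by_contra hx
  have h1 := antiOne_anS_imp (antiTwo_anS_imp (rest_anS_imp (by simpa using hx)))
  have h2 := emitted_debt_le u (i - 1 - 1 - 1)
  rw [sendForward_sta_of_not_dfc (hd _), h1, show i - 1 - 1 - 1 = i - 3 by ring] at h2
  simp [debt] at h0
  simp [h0] at h2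

/-- There are no debts on the left of `L`, and no anti-signal at `L`. -/
structure Swept (u : Config) (L : ℤ) : Prop where
  sta : ∀ i < L, (u i).sta = 0
  anS : ∀ i ≤ L, (u i).anS = false

lemma Swept.debt {L : ℤ} (W : Swept u L) {i : ℤ} (hi : i < L) : debt (u i) = 0 := by
  simp [ASR.debt, W.sta i hi, W.anS i hi.le]

/-- The total of the stacks. -/
noncomputable def stackSum (lo hi : ℤ) (u : Config) : ℕ := ∑ i ∈ Finset.Ico lo (hi + 1), (u i).sta

/-- The height vanishes at `r`, so the debts are outnumbered by the signals, at most two per site.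
-/
lemma Inv.stackSum_le (I : Inv lo hi r u h) (hle : lo ≤ hi) :
    (stackSum lo hi u : ℤ) ≤ 2 * (r + 1 - lo) := by
  have h0 := I.le
  have h1 := sum_debt_eq I.height (m := lo) (n := r + 1) (by omega)
  rw [add_sub_cancel_right, I.height_right r le_rfl] at h1
  have h2 := I.nonneg (lo - 1)
  have h3 := sum_signals_le u (m := lo) (n := r + 1) (by omega)
  have h4 : stackSum lo hi u ≤ ∑ i ∈ Finset.Ico lo (r + 1), ASR.debt (u i) :=
    (Finset.sum_le_sum fun i _ => Nat.le_add_right _ _).trans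
      (Finset.sum_le_sum_of_subset (Finset.Ico_subset_Ico le_rfl (by omega)))
  omega

/-- If the stack at `L` is empty the sweep advances; otherwise no anti-signal blocks the emission at
`L`, and that stack decreases. -/
lemma Swept.rest {L : ℤ} (W : Swept u L) (I : Inv lo hi r u h)
    (hd : ∀ i, (u i).dfc = false) :
    ∃ L', Swept (rest u) L' ∧ L ≤ L' ∧
      (stackSum lo hi (ASR.rest u) : ℤ) - L' + 1 ≤ stackSum lo hi u - L := by
  have hS : stackSum lo hi (ASR.rest u) ≤ stackSum lo hi u :=
    Finset.sum_le_sum fun i _ => rest_sta_le (hd i)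
  have ha : ∀ i ≤ L + 1, (ASR.rest u i).anS = false := fun i hi =>
    rest_anS_of_debt hd (W.debt (by omega))
  have hs : ∀ i, (u i).sta = 0 → (ASR.rest u i).sta = 0 := fun i hi => by
    have := rest_sta_le (hd i); omega
  by_cases h0 : (u L).sta = 0
  · refine ⟨L + 1, ⟨fun i hi => hs i ?_, ha⟩, by omega, by omega⟩
    rcases (show i ≤ L by omega).lt_or_eq with h1 | rfl
    · exact W.sta i h1
    · exact h0
  · refine ⟨L, ⟨fun i hi => hs i (W.sta i hi), fun i hi => ha i (by omega)⟩, le_rfl, ?_⟩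
    have hlt : stackSum lo hi (ASR.rest u) < stackSum lo hi u := by
      refine Finset.sum_lt_sum (fun i _ => rest_sta_le (hd i))
        ⟨L, ?_, rest_sta_lt hd (by omega) (W.anS L le_rfl)⟩
      have h1 := I.sta_le L (by omega)
      rw [Finset.mem_Ico]
      refine ⟨?_, by omega⟩
      by_contra hx
      rw [I.left L (by omega)] at h0
      exact h0 rfl
    omega

lemma Inv.swept (I : Inv lo hi r u h) : Swept u (lo - 1) := by
  refine ⟨fun i hi => ?_, fun i hi => ?_⟩ <;> rw [I.left i (by omega)] <;> rfl

lemma Inv.sta_eq_zero (I : Inv lo hi r u h) {L : ℤ} (W : Swept u L) (hL : hi < L) (i : ℤ) :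
    (u i).sta = 0 := by
  by_contra hx
  have := I.sta_le i (by omega)
  exact hx (W.sta i (by omega))

/-- Beyond `r` every site is empty. -/
lemma Inv.right (I : Inv lo hi r u h) {i : ℤ} (hi : r < i) : u i = Site.zero := by
  have h0 := I.le
  have h1 := I.height i
  rw [I.height_right i hi.le, I.height_right (i - 1) (by omega)] at h1
  have hf : (u i).fwS = false := by
    by_contra hx; have := I.fwS_le i (by simpa using hx); omega
  have hb : (u i).bwS = false := by
    by_contra hx; have := I.bwS_le i (by simpa using hx); omega
  have hd : (u i).dfc = false := by
    by_contra hx; have := I.dfc_le i (by simpa using hx); omega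
  have ha := toInt_nonneg (u i).anS
  simp only [charge, hf, hb, Bool.toInt_false] at h1
  ext1
  · exact hd
  · exact hf
  · exact hb
  · exact eq_false_of_toInt (by omega)
  · simp only [Site.zero]; omega

/-- A configuration without defects and debts is empty. -/
lemma Inv.eq_zero (I : Inv lo hi r u h) (hd : ∀ i, (u i).dfc = false)
    (h0 : ∀ i, debt (u i) = 0) (i : ℤ) : u i = Site.zero := by
  -- Without debts the height is nonincreasing; starting from zero and staying nonnegative, it
  -- vanishes, and with it all signals.
  have key : ∀ i, lo - 1 ≤ i → h i = 0 := by
    intro i hi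
    induction i, hi using Int.leInduction with
    | base => exact I.height_left _ (by omega)
    | succ i _ ih =>
      have h1 := I.height (i + 1)
      have h2 := I.nonneg (i + 1)
      have h3 := h0 (i + 1)
      simp only [debt, Nat.add_eq_zero_iff, toNat_eq_zero] at h3
      have := toInt_nonneg (u (i + 1)).fwS
      have := toInt_nonneg (u (i + 1)).bwS
      simp only [add_sub_cancel_right, charge, ih, h3, Bool.toInt_false] at h1
      push_cast at h1
      omega
  rcases lt_or_ge i lo with hi | hi
  · exact I.left i hi
  have h1 := I.height i
  have h3 := h0 i
  simp only [debt, Nat.add_eq_zero_iff, toNat_eq_zero] at h3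
  have := toInt_nonneg (u i).fwS
  have := toInt_nonneg (u i).bwS
  simp only [charge, key i (by omega), key (i - 1) (by omega), h3, Bool.toInt_false] at h1
  push_cast at h1
  ext1
  · exact hd i
  · exact eq_false_of_toInt (by omega)
  · exact eq_false_of_toInt (by omega)
  · exact h3.2
  · exact h3.1

/-- Erasure of the signals of a sequence of configurations without defects. -/
theorem erasure {v : ℕ → Config} {n : ℕ} (hle : lo ≤ hi)
    (hv : ∀ k, v (k + 1) = iteration 3 3 (v k)) (hI : ∀ k : ℕ, ∃ h, Inv lo hi (hi + k) (v k) h)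
    (hd : ∀ k, n ≤ k → ∀ i, (v k i).dfc = false) {k : ℕ}
    (hk : 9 * n + 9 * (hi - lo) + 15 ≤ 2 * k) (i : ℤ) : v k i = Site.zero := by
  have hr : ∀ k, n ≤ k → v (k + 1) = rest (v k) := fun k hk => by
    rw [hv, iteration_eq_rest (hd k hk)]
  have sweep : ∀ j : ℕ, ∃ L, Swept (v (n + j)) L ∧ (hi < L ∨
      (stackSum lo hi (v (n + j)) : ℤ) + hi + 1 - L ≤
        2 * (hi + n + 1 - lo) + (hi + 2 - lo) - j) := by
    intro j
    induction j with
    | zero =>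
      obtain ⟨h, I⟩ := hI n
      refine ⟨lo - 1, I.swept, Or.inr ?_⟩
      have := I.stackSum_le hle
      push_cast
      simp only [add_zero]
      omega
    | succ j ih =>
      obtain ⟨L, W, hL⟩ := ih
      obtain ⟨h, I⟩ := hI (n + j)
      obtain ⟨L', W', h1, h2⟩ := W.rest I (hd _ (by omega))
      rw [← add_assoc, hr _ (by omega)]
      refine ⟨L', W', ?_⟩
      push_cast
      omega
  -- After this many steps the bound of `sweep` reaches zero, which forces `hi < L`.
  obtain ⟨m, hm⟩ : ∃ m : ℕ, (m : ℤ) = 2 * (hi + n + 1 - lo) + (hi + 2 - lo) :=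
    ⟨(2 * (hi + n + 1 - lo) + (hi + 2 - lo)).toNat, by omega⟩
  -- All stacks being empty, the anti-signal-free region gains three sites per iteration.
  have wave : ∀ j : ℕ, (∀ i, (v (n + m + j) i).sta = 0) ∧
      ∀ i ≤ hi + 3 * j, (v (n + m + j) i).anS = false := by
    intro j
    induction j with
    | zero =>
      obtain ⟨L, W, hL⟩ := sweep m
      obtain ⟨h, I⟩ := hI (n + m)
      have hL : hi < L := by omega
      refine ⟨I.sta_eq_zero W hL, fun i hi => W.anS i ?_⟩
      push_cast at hi
      omega
    | succ j ih =>
      have hd' := hd (n + m + j) (by omega)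
      rw [← add_assoc, hr _ (by omega)]
      refine ⟨fun i => ?_, fun i hi => rest_anS_of_debt hd' ?_⟩
      · have := rest_sta_le (hd' i)
        rw [ih.1] at this
        omega
      · push_cast at hi
        simp [debt, ih.1, ih.2 (i - 3) (by omega)]
  obtain ⟨h, I⟩ := hI k
  obtain ⟨j, rfl⟩ : ∃ j, k = n + m + j := ⟨k - (n + m), by omega⟩
  refine I.eq_zero (hd _ (by omega)) (fun i => ?_) i
  rw [debt, (wave j).1]
  by_cases h1 : i ≤ hi + 3 * j
  · simp [(wave j).2 i h1]
  -- The support ends at `hi + n + m + j`, which `hi + 3 * j` exceeds as soon as `2 * j > n + m`;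
  -- hence the lower bound of about `3 * (n + m) / 2` on `k`.
  · rw [I.right (i := i) (by push_cast at hk ⊢; omega)]
    rfl

end
end ASR

/-! ### The initial configuration and the final bounds -/

namespace ASR
section
variable {lo hi : ℤ} {S : Finset ℤ}

lemma initial_dfc (S : Finset ℤ) (i : ℤ) : (initial S i).dfc = decide (i ∈ S) := rfl

lemma inv_initial (hS : ∀ i ∈ S, lo ≤ i ∧ i ≤ hi) : Inv lo hi hi (initial S) fun _ => 0 := by
  refine ⟨fun i => by simp [initial, charge, Site.zero], by simp, fun i hi => ?_, by simp, by simp,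
    by simp [initial, Site.zero], by simp, by simp [initial, Site.zero],
    by simp [initial, Site.zero], by simp [initial, Site.zero], fun i hd => ?_,
    by simp [initial, Site.zero], by simp [initial, Site.zero], by simp [initial, Site.zero],
    le_rfl⟩
  · have : i ∉ S := fun hx => by have := hS i hx; omega
    simp [initial, this, Site.zero]
  · exact (hS i (by simpa [initial_dfc] using hd)).2

lemma par_initial (hS : ∀ i ∈ S, lo ≤ i ∧ i ≤ hi) (hev : Even S.card) :
    Par lo hi (initial S) fun i => decide (Odd (S.filter (· ≤ i)).card) := by
  refine ⟨fun i => ?_, fun i hi => ?_, fun i hi => ?_⟩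
  · rw [initial_dfc]
    by_cases h : i ∈ S
    · have : S.filter (· ≤ i) = insert i (S.filter (· ≤ i - 1)) := by
        ext j; simp only [Finset.mem_filter, Finset.mem_insert]
        constructor
        · intro h1
          by_cases h2 : j = i
          · exact Or.inl h2
          · exact Or.inr ⟨h1.1, by omega⟩
        · rintro (rfl | h1)
          · exact ⟨h, le_rfl⟩
          · exact ⟨h1.1, by omega⟩
      rw [this, Finset.card_insert_of_notMem (by simp)]
      generalize (S.filter (· ≤ i - 1)).card = n
      by_cases h3 : Odd n <;> simp [h, h3, Nat.odd_add_one]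
    · have : S.filter (· ≤ i) = S.filter (· ≤ i - 1) := by
        refine Finset.filter_congr fun j hj => ?_
        have : j ≠ i := by rintro rfl; exact h hj
        omega
      simp [this, h]
  · have : S.filter (· ≤ i) = ∅ := by
      refine Finset.filter_false_of_mem fun j hj => ?_
      have := hS j hj
      omega
    simp [this]
  · have : S.filter (· ≤ i) = S := by
      refine Finset.filter_true_of_mem fun j hj => ?_
      have := hS j hj
      omega
    simp [this, hev]

lemma front_initial {c : ℤ → Bool} (hS : ∀ i ∈ S, lo ≤ i ∧ i ≤ hi) (hlo : lo ∈ S)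
    (P : Par lo hi (initial S) c) :
    Front 0 hi (initial S) c lo (5 * (hi - lo)) := by
  have hc : c lo = true := by
    have := P.step lo
    rw [P.left (lo - 1) (by omega), initial_dfc] at this
    simpa [hlo] using this
  have hB : Behind (initial S) c lo := by
    have key : ∀ i ≤ lo, c i = true → (initial S i).dfc = true := by
      intro i hi hx
      rcases hi.lt_or_eq with h1 | rfl
      · simp [P.left i h1] at hx
      · simp [initial_dfc, hlo]
    refine ⟨fun i hi h1 h2 => ?_, fun i hi h1 h2 => ?_, fun i _ _ => rfl, fun i hi h1 _ => ?_⟩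
    · simp [key i hi h1] at h2
    · simp [key i hi.le h1] at h2
    · have := hS i (by simpa [initial_dfc] using h1)
      omega
  refine ⟨hB, Or.inr ⟨hc, ?_⟩⟩
  obtain ⟨y, N⟩ := P.exists_next hc
  refine ⟨y, N, ?_⟩
  have := N.lt
  have h1 : blocks 0 (initial S) (lo + 1) y = 0 := by simp [blocks, initial, Site.zero]
  have h2 : load (initial S) lo y = 0 := by simp [load, debt, initial, Site.zero]
  rw [h1, h2]
  push_cast
  omega

/-- Confinement and erasure, for an even set of defects in `[lo, hi]`. -/
theorem evolution_confined (hS : ∀ i ∈ S, lo ≤ i ∧ i ≤ hi) (hlo : lo ∈ S) (hev : Even S.card) :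
    (∀ t : ℕ, ∃ h, Inv lo hi (hi + t) (evolution S t) h) ∧
      ∀ t : ℕ, 63 * (hi - lo) + 15 ≤ 2 * t → ∀ i, evolution S t i = Site.zero := by
  have hle := (hS lo hlo).2
  have I := inv_initial hS
  have P := par_initial hS hev
  have F := front_initial hS hlo P
  have hI : ∀ t : ℕ, ∃ h, Inv lo hi (hi + t) (evolution S t) h := fun t => by
    obtain ⟨h, -, -, I', -⟩ := F.iterate P I hle (by omega) t
    exact ⟨h, I'⟩
  refine ⟨hI, fun t ht => ?_⟩
  -- Five widths for the front to pass `hi`, one more for the odd sites to vanish.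
  obtain ⟨n, hn⟩ : ∃ n : ℕ, (n : ℤ) = 6 * (hi - lo) := ⟨(6 * (hi - lo)).toNat, by omega⟩
  exact erasure (n := n) hle (fun k => Function.iterate_succ_apply' _ _ _) hI
    (fun k hk => F.iterate_dfc P I hle (by omega) (by omega)) (by omega)

end
end ASR

theorem theorem2 (m : ℕ) (hm : 1 ≤ m) (σ : ℕ → ℤ)
    (hσ : StrictMonoOn σ (Set.Icc 1 (2 * m))) (S : Finset ℤ)
    (hS : S = (Finset.Icc 1 (2 * m)).image σ) (Δ : ℤ) (hΔ : Δ = σ (2 * m) - σ 1) :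
    (∀ t : ℕ, ASR.defects (ASR.evolution S t) ⊆ Set.Icc (σ 1) (σ 1 + Δ) ∧
      ASR.supp (ASR.evolution S t) ⊆ Set.Icc (σ 1) (σ 1 + 78 * Δ)) ∧
    (∀ t : ℕ, 77 * Δ < (t : ℤ) → ASR.supp (ASR.evolution S t) = ∅) := by
  have mem1 : 1 ∈ Set.Icc 1 (2 * m) := ⟨le_rfl, by omega⟩
  have mem2 : 2 * m ∈ Set.Icc 1 (2 * m) := ⟨by omega, le_rfl⟩
  have hpos : σ 1 < σ (2 * m) := hσ mem1 mem2 (by omega)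
  have hb : ∀ i ∈ S, σ 1 ≤ i ∧ i ≤ σ (2 * m) := by
    intro i hi
    rw [hS, Finset.mem_image] at hi
    obtain ⟨k, hk, rfl⟩ := hi
    rw [Finset.mem_Icc] at hk
    exact ⟨hσ.monotoneOn mem1 hk hk.1, hσ.monotoneOn hk mem2 hk.2⟩
  have hlo : σ 1 ∈ S := by
    rw [hS]
    exact Finset.mem_image_of_mem _ (Finset.mem_Icc.2 mem1)
  have hev : Even S.card := by
    rw [hS, Finset.card_image_of_injOn (by simpa using hσ.injOn), Nat.card_Icc]
    exact ⟨m, by omega⟩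
  obtain ⟨h1, h2⟩ := ASR.evolution_confined hb hlo hev
  have h3 : ∀ t : ℕ, 77 * Δ < (t : ℤ) → ASR.supp (ASR.evolution S t) = ∅ := by
    intro t ht
    -- Since `Δ ≥ 1`, `t > 77 * Δ` implies `2 * t ≥ 63 * Δ + 15`.
    refine Set.eq_empty_of_forall_notMem fun i hi => hi (h2 t (by omega) i)
  refine ⟨fun t => ?_, h3⟩
  obtain ⟨h, I⟩ := h1 t
  have hleft : ∀ i, ASR.evolution S t i ≠ ASR.Site.zero → σ 1 ≤ i := by
    intro i hi
    by_contra hx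
    exact hi (I.left i (by omega))
  refine ⟨fun i hi => ?_, fun i hi => ?_⟩
  · have h4 : (ASR.evolution S t i).dfc = true := hi
    refine ⟨hleft i fun hx => ?_, ?_⟩
    · simp [hx, ASR.Site.zero] at h4
    · have := I.dfc_le i h4
      omega
  · refine ⟨hleft i hi, ?_⟩
    by_contra hx
    by_cases ht : 77 * Δ < (t : ℤ)
    · simp [h3 t ht] at hi
    -- For `t ≤ 77 * Δ` the support ends at most at `σ (2 * m) + t ≤ σ 1 + 78 * Δ`.
    · exact hi (I.right (by omega))
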